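/- Let $V_{\mathbb R}$ be a real Euclidean space of finite dimension $\ell$ and let $W\subset O(V_{\mathbb R})$ be a finite group generated by (orthogonal) reflections. Put $V=\mathbb C\otimes V_{\mathbb R}$, let $S$ be the set of all reflections in $W$, let $S/W$ be the set of its conjugacy classes under $W$, and let $\mathbb C(c)$ be the field of rational functions over $\mathbb C$ in independent variables indexed by $S/W$; for $s\in S$ let $c(s)\in\mathbb C(c)$ be the variable of the class of $s$. Put $S_c(V)=\mathbb C(c)\otimes S(V)$. Identify $V$ with $V^*$ by the scalar product, and for $y\in V$ let $$\nabla_y=\partial_y-\sum_{s\in S}c(s)\,\frac{\langle y,\alpha_s\rangle}{\alpha_s}\,(1-s)$$ be the Dunkl operator on $S_c(V)$, where $\partial_y$ is the derivation with $\partial_y(x)=\langle y,x\rangle$ for $x\in V$, and $\alpha_s\in V_{\mathbb R}$ is a nonzero vector orthogonal to the mirror of $s$. The operators $\nabla_y$ commute; define $\nabla_p$ for $p\in S_c(V)$ by $\mathbb C(c)$-linearity and $\nabla_{pq}=\nabla_p\nabla_q$, and put $(f,g)_c=[\nabla_f(g)]_0\in\mathbb C(c)$, where $[\,\cdot\,]_0$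 is the constant term. A homogeneous generating set of $S(V)^W$ is a list $u_1,\dots,u_\ell$ of algebraically independent homogeneous elements that generate the algebra $S(V)^W$, listed so that their degrees $d_1\le\dots\le d_\ell$ increase weakly; the degrees depend only on $W$. For $a\in\mathbb Z_{\ge0}^\ell$ write $u^a=u_1^{a_1}\cdots u_\ell^{a_\ell}$. For $a,a'\in\mathbb Z_{\ge 0}^\ell$ write $a'\prec a$ if $a'\neq a$ and the last nonzero coordinate of $a-a'$ is positive. **Theorem.** Suppose that the degrees $d_1,\dots,d_\ell$ of $W$ are pairwise distinct. Then for each $a\in\mathbb Z_{\ge0}^\ell$ there is a homogeneous element $b_a\in S_c(V)^W=\mathbb C(c)\otimes S(V)^W$, unique up to multiplication by a nonzero complex constant, such that for every homogeneous generating set $u_1,\dots,u_\ell$ of $S(V)^W$: 1. $b_a\in\mathbb C^\times\cdot u^a+\sum_{a'\prec a}\mathbb C(c)\cdot u^{a'}$; 2. $(u^{a'},b_a)_c=0$ for all $a'\prec a$. -/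

import Mathlib

open scoped InnerProductSpace

noncomputable section

namespace Dunkl

/- Throughout, `V` is the real Euclidean space on which the group acts and `e` is an orthonormal
basis of it.  The symmetric algebra over a field `K ⊇ ℝ` of the scalar extension `K ⊗ V` is the
polynomial ring `MvPolynomial (Fin ℓ) K`, in which the variable `X i` is the vector `e i`. -/

/-- The vector `v` of `V`, as an element of degree one of the symmetric algebra. -/
def lin (K : Type*) [Field K] [Algebra ℝ K] {V : Type*} [NormedAddCommGroup V]
    [InnerProductSpace ℝ V] {ℓ : ℕ} (e : OrthonormalBasis (Fin ℓ) ℝ V) (v : V) :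
    MvPolynomial (Fin ℓ) K :=
  ∑ i, MvPolynomial.C (algebraMap ℝ K (e.repr v i)) * MvPolynomial.X i

/-- The action of an isometry of `V` on the symmetric algebra by algebra homomorphisms. -/
def act (K : Type*) [Field K] [Algebra ℝ K] {V : Type*} [NormedAddCommGroup V]
    [InnerProductSpace ℝ V] {ℓ : ℕ} (e : OrthonormalBasis (Fin ℓ) ℝ V) (w : V ≃ₗᵢ[ℝ] V) :
    MvPolynomial (Fin ℓ) K →ₐ[K] MvPolynomial (Fin ℓ) K :=
  MvPolynomial.aeval fun i => lin K e (w (e i))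

/-- The algebra of `W`-invariants in the symmetric algebra over `K`. -/
def invariants (K : Type*) [Field K] [Algebra ℝ K] {V : Type*} [NormedAddCommGroup V]
    [InnerProductSpace ℝ V] {ℓ : ℕ} (e : OrthonormalBasis (Fin ℓ) ℝ V)
    (W : Subgroup (V ≃ₗᵢ[ℝ] V)) : Subalgebra K (MvPolynomial (Fin ℓ) K) where
  carrier := {f | ∀ w ∈ W, act K e w f = f}
  mul_mem' := fun hf hg w hw => by rw [map_mul, hf w hw, hg w hw]
  add_mem' := fun hf hg w hw => by rw [map_add, hf w hw, hg w hw]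
  algebraMap_mem' := fun r w _ => (act K e w).commutes r

/-- `s` is the orthogonal reflection in the hyperplane orthogonal to some nonzero vector. -/
def IsReflection {V : Type*} [NormedAddCommGroup V] [InnerProductSpace ℝ V]
    (s : V ≃ₗᵢ[ℝ] V) : Prop :=
  ∃ α : V, α ≠ 0 ∧ s = (ℝ ∙ α)ᗮ.reflection

/-- The set `S` of all reflections in `W`. -/
def Refl {V : Type*} [NormedAddCommGroup V] [InnerProductSpace ℝ V]
    (W : Subgroup (V ≃ₗᵢ[ℝ] V)) : Type _ :=
  {s : W // IsReflection (s : V ≃ₗᵢ[ℝ] V)}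

instance {V : Type*} [NormedAddCommGroup V] [InnerProductSpace ℝ V]
    (W : Subgroup (V ≃ₗᵢ[ℝ] V)) [Finite W] : Fintype (Refl W) :=
  @Fintype.ofFinite _ (inferInstanceAs (Finite {s : W // IsReflection (s : V ≃ₗᵢ[ℝ] V)}))

/-- A root of the reflection `s`: a nonzero vector orthogonal to its mirror.  Dunkl operators do
not change when a root is multiplied by a nonzero scalar. -/
def root {V : Type*} [NormedAddCommGroup V] [InnerProductSpace ℝ V]
    {W : Subgroup (V ≃ₗᵢ[ℝ] V)} (s : Refl W) : V :=
  s.2.choose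

theorem root_ne_zero {V : Type*} [NormedAddCommGroup V] [InnerProductSpace ℝ V]
    {W : Subgroup (V ≃ₗᵢ[ℝ] V)} (s : Refl W) : root s ≠ 0 :=
  s.2.choose_spec.1

theorem reflection_root {V : Type*} [NormedAddCommGroup V] [InnerProductSpace ℝ V]
    {W : Subgroup (V ≃ₗᵢ[ℝ] V)} (s : Refl W) :
    (s.1 : V ≃ₗᵢ[ℝ] V) = (ℝ ∙ root s)ᗮ.reflection :=
  s.2.choose_spec.2

theorem lin_add_smul (K : Type*) [Field K] [Algebra ℝ K] {V : Type*} [NormedAddCommGroup V]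
    [InnerProductSpace ℝ V] {ℓ : ℕ} (e : OrthonormalBasis (Fin ℓ) ℝ V) (v w : V) (r : ℝ) :
    lin K e (v + r • w) = lin K e v + MvPolynomial.C (algebraMap ℝ K r) * lin K e w := by
  simp only [lin, Finset.mul_sum, ← Finset.sum_add_distrib]
  refine Finset.sum_congr rfl fun i _ => ?_
  simp only [map_add, map_smul, PiLp.add_apply, PiLp.smul_apply, smul_eq_mul, map_mul]
  ring

theorem lin_basis (K : Type*) [Field K] [Algebra ℝ K] {V : Type*} [NormedAddCommGroup V]
    [InnerProductSpace ℝ V] {ℓ : ℕ} (e : OrthonormalBasis (Fin ℓ) ℝ V) (i : Fin ℓ) :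
    lin K e (e i) = MvPolynomial.X i := by
  classical
  rw [lin, Finset.sum_eq_single i]
  · simp
  · intro j _ hj
    simp [hj]
  · simp

theorem lin_ne_zero (K : Type*) [Field K] [Algebra ℝ K] {V : Type*} [NormedAddCommGroup V]
    [InnerProductSpace ℝ V] {ℓ : ℕ} (e : OrthonormalBasis (Fin ℓ) ℝ V) {v : V} (hv : v ≠ 0) :
    lin K e v ≠ 0 := by
  classical
  intro h
  apply hv
  apply e.repr.injective
  ext i
  have h1 := congrArg (MvPolynomial.coeff (Finsupp.single i 1)) h
  simp only [lin, MvPolynomial.coeff_sum, MvPolynomial.coeff_C_mul, MvPolynomial.coeff_X,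
    MvPolynomial.coeff_zero] at h1
  rw [Finset.sum_eq_single i] at h1
  · simpa using h1
  · intro j _ hj
    simp [Finsupp.single_left_inj, hj]
  · simp

/-- The root of `s` divides `f - s(f)` for each `f`. -/
theorem lin_root_dvd (K : Type*) [Field K] [Algebra ℝ K] {V : Type*} [NormedAddCommGroup V]
    [InnerProductSpace ℝ V] {ℓ : ℕ} (e : OrthonormalBasis (Fin ℓ) ℝ V)
    {W : Subgroup (V ≃ₗᵢ[ℝ] V)} (s : Refl W) (f : MvPolynomial (Fin ℓ) K) :
    lin K e (root s) ∣ f - act K e s.1 f := by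
  have key : (Ideal.Quotient.mkₐ K (Ideal.span {lin K e (root s)})).comp (act K e s.1) =
      Ideal.Quotient.mkₐ K (Ideal.span {lin K e (root s)}) := by
    refine MvPolynomial.algHom_ext fun i => ?_
    simp only [AlgHom.comp_apply, act, MvPolynomial.aeval_X, Ideal.Quotient.mkₐ_eq_mk]
    rw [Ideal.Quotient.eq, Ideal.mem_span_singleton, ← lin_basis K e i, lin_basis K e i]
    have hs : (s.1 : V ≃ₗᵢ[ℝ] V) (e i) =
        e i + (-(2 * (⟪root s, e i⟫_ℝ / ((‖root s‖ : ℝ) ^ 2)))) • root s := by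
      rw [reflection_root s, Submodule.reflection_orthogonal_apply,
        Submodule.reflection_singleton_apply]
      simp only [RCLike.ofReal_real_eq_id, id]
      rw [neg_sub, neg_smul, ← sub_eq_add_neg, mul_smul, two_smul, two_smul]
    rw [hs, lin_add_smul, lin_basis, add_sub_cancel_left]
    exact Dvd.intro_left _ rfl
  have h := DFunLike.congr_fun key f
  rw [AlgHom.comp_apply, Ideal.Quotient.mkₐ_eq_mk, Ideal.Quotient.eq,
    Ideal.mem_span_singleton] at h
  rw [← neg_sub]
  exact (dvd_neg).2 h

/-- The divided difference `f ↦ (f - s(f)) / α_s`. -/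
def divDiff (K : Type*) [Field K] [Algebra ℝ K] {V : Type*} [NormedAddCommGroup V]
    [InnerProductSpace ℝ V] {ℓ : ℕ} (e : OrthonormalBasis (Fin ℓ) ℝ V)
    {W : Subgroup (V ≃ₗᵢ[ℝ] V)} (s : Refl W) : Module.End K (MvPolynomial (Fin ℓ) K) where
  toFun f := (lin_root_dvd K e s f).choose
  map_add' f g := by
    apply mul_left_cancel₀ (lin_ne_zero K e (root_ne_zero s))
    rw [mul_add, ← (lin_root_dvd K e s f).choose_spec, ← (lin_root_dvd K e s g).choose_spec,
      ← (lin_root_dvd K e s (f + g)).choose_spec, map_add]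
    ring
  map_smul' r f := by
    apply mul_left_cancel₀ (lin_ne_zero K e (root_ne_zero s))
    rw [RingHom.id_apply, mul_smul_comm, ← (lin_root_dvd K e s f).choose_spec,
      ← (lin_root_dvd K e s (r • f)).choose_spec, map_smul, smul_sub]

theorem lin_root_mul_divDiff (K : Type*) [Field K] [Algebra ℝ K] {V : Type*}
    [NormedAddCommGroup V] [InnerProductSpace ℝ V] {ℓ : ℕ} (e : OrthonormalBasis (Fin ℓ) ℝ V)
    {W : Subgroup (V ≃ₗᵢ[ℝ] V)} (s : Refl W) (f : MvPolynomial (Fin ℓ) K) :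
    lin K e (root s) * divDiff K e s f = f - act K e s.1 f :=
  (lin_root_dvd K e s f).choose_spec.symm

/-- The Dunkl operator `∇_y = ∂_y - ∑ₛ c(s) ⟨y, α_s⟩ / α_s (1 - s)`, where `V` and its dual are
identified by the scalar product: `∂_y` is the derivation that sends a vector `x` to `⟨y, x⟩`. -/
def dunkl {K : Type*} [Field K] [Algebra ℝ K] {V : Type*} [NormedAddCommGroup V]
    [InnerProductSpace ℝ V] {ℓ : ℕ} (e : OrthonormalBasis (Fin ℓ) ℝ V)
    {W : Subgroup (V ≃ₗᵢ[ℝ] V)} [Finite W] (c : Refl W → K) (y : V) :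
    Module.End K (MvPolynomial (Fin ℓ) K) :=
  (MvPolynomial.mkDerivation K fun i =>
      (MvPolynomial.C (algebraMap ℝ K ⟪y, e i⟫_ℝ) : MvPolynomial (Fin ℓ) K)).toLinearMap
    - ∑ s : Refl W, (c s * algebraMap ℝ K ⟪y, root s⟫_ℝ) • divDiff K e s

/-- The operator `∇_p`, obtained from `p` by substituting `∇_{e i}` for the variable `X i`.
If `c` is constant on conjugacy classes, these operators commute, so the order
in which the factors are written here does not matter, and `∇_{pq} = ∇_p ∇_q`. -/
def dunklPoly {K : Type*} [Field K] [Algebra ℝ K] {V : Type*} [NormedAddCommGroup V]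
    [InnerProductSpace ℝ V] {ℓ : ℕ} (e : OrthonormalBasis (Fin ℓ) ℝ V)
    {W : Subgroup (V ≃ₗᵢ[ℝ] V)} [Finite W] (c : Refl W → K) (p : MvPolynomial (Fin ℓ) K) :
    Module.End K (MvPolynomial (Fin ℓ) K) :=
  ∑ m ∈ p.support, p.coeff m • ((List.finRange ℓ).map fun i => dunkl e c (e i) ^ m i).prod

/-- The form `(f, g)_c`, the constant term of `∇_f g`. -/
def form {K : Type*} [Field K] [Algebra ℝ K] {V : Type*} [NormedAddCommGroup V]
    [InnerProductSpace ℝ V] {ℓ : ℕ} (e : OrthonormalBasis (Fin ℓ) ℝ V)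
    {W : Subgroup (V ≃ₗᵢ[ℝ] V)} [Finite W] (c : Refl W → K) (f g : MvPolynomial (Fin ℓ) K) : K :=
  MvPolynomial.constantCoeff (dunklPoly e c f g)

/-- The set `S/W` of `W`-conjugacy classes of reflections in `W`. -/
def ReflClass {V : Type*} [NormedAddCommGroup V] [InnerProductSpace ℝ V]
    (W : Subgroup (V ≃ₗᵢ[ℝ] V)) : Type _ :=
  Quotient ((IsConj.setoid W).comap (fun s : Refl W => s.1))

/-- The field `ℂ(c)` of rational functions on the affine space with coordinates indexed by
`S/W`. -/
abbrev ParamField {V : Type*} [NormedAddCommGroup V] [InnerProductSpace ℝ V]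
    (W : Subgroup (V ≃ₗᵢ[ℝ] V)) : Type _ :=
  FractionRing (MvPolynomial (ReflClass W) ℂ)

/-- The generic parameter function: `c(s)` is the coordinate of the class of `s`. -/
def param {V : Type*} [NormedAddCommGroup V] [InnerProductSpace ℝ V]
    (W : Subgroup (V ≃ₗᵢ[ℝ] V)) (s : Refl W) : ParamField W :=
  algebraMap (MvPolynomial (ReflClass W) ℂ) (ParamField W)
    (MvPolynomial.X (Quotient.mk ((IsConj.setoid W).comap (fun s : Refl W => s.1)) s))

/-- `u` is a homogeneous generating set of `S(V)^W`, listed so that the degrees `d` increase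
weakly: the `u i` are homogeneous of degree `d i`, and `S(V)^W` is the algebra of polynomials
in them. -/
structure IsHomogeneousGenerators {V : Type*} [NormedAddCommGroup V] [InnerProductSpace ℝ V]
    {ℓ : ℕ} (e : OrthonormalBasis (Fin ℓ) ℝ V) (W : Subgroup (V ≃ₗᵢ[ℝ] V))
    (d : Fin ℓ → ℕ) (u : Fin ℓ → MvPolynomial (Fin ℓ) ℂ) : Prop where
  homogeneous : ∀ i, (u i).IsHomogeneous (d i)
  monotone : Monotone d
  algebraicIndependent : AlgebraicIndependent ℂ u
  generate : Algebra.adjoin ℂ (Set.range u) = invariants ℂ e W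

/-- `d` is the list of degrees of `W`. -/
def IsDegrees {V : Type*} [NormedAddCommGroup V] [InnerProductSpace ℝ V]
    {ℓ : ℕ} (e : OrthonormalBasis (Fin ℓ) ℝ V) (W : Subgroup (V ≃ₗᵢ[ℝ] V))
    (d : Fin ℓ → ℕ) : Prop :=
  ∃ u : Fin ℓ → MvPolynomial (Fin ℓ) ℂ, IsHomogeneousGenerators e W d u

/-- The inverse lexicographic order: the last nonzero coordinate of `a - a'` is positive. -/
def Prec {ℓ : ℕ} (a' a : Fin ℓ → ℕ) : Prop :=
  ∃ i, a' i < a i ∧ ∀ j, i < j → a' j = a j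

/-- The monomial `u^a`, as an element of `S_c(V)`. -/
def mono {V : Type*} [NormedAddCommGroup V] [InnerProductSpace ℝ V] {ℓ : ℕ}
    (W : Subgroup (V ≃ₗᵢ[ℝ] V)) (u : Fin ℓ → MvPolynomial (Fin ℓ) ℂ) (a : Fin ℓ → ℕ) :
    MvPolynomial (Fin ℓ) (ParamField W) :=
  MvPolynomial.map (algebraMap ℂ (ParamField W)) (∏ i, u i ^ a i)

/-- The two conditions on `b` relative to the generators `u`: `b` is a nonzero complex multiple
of `u^a` plus a `ℂ(c)`-combination of the `u^a'` with `a' ≺ a`, and it is orthogonal to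
these `u^a'`. -/
structure IsCanonical {V : Type*} [NormedAddCommGroup V] [InnerProductSpace ℝ V] {ℓ : ℕ}
    (e : OrthonormalBasis (Fin ℓ) ℝ V) (W : Subgroup (V ≃ₗᵢ[ℝ] V)) [Finite W]
    (u : Fin ℓ → MvPolynomial (Fin ℓ) ℂ) (a : Fin ℓ → ℕ)
    (b : MvPolynomial (Fin ℓ) (ParamField W)) : Prop where
  leading : ∃ z : ℂ, z ≠ 0 ∧
    b - z • mono W u a ∈ Submodule.span (ParamField W) {f | ∃ a', Prec a' a ∧ f = mono W u a'}
  orthogonal : ∀ a', Prec a' a → form e (param W) (mono W u a') b = 0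

/-- `b` is a canonical invariant with index `a`: a homogeneous `W`-invariant that satisfies the
two conditions relative to every homogeneous generating set. -/
def IsCanonicalInvariant {V : Type*} [NormedAddCommGroup V] [InnerProductSpace ℝ V] {ℓ : ℕ}
    (e : OrthonormalBasis (Fin ℓ) ℝ V) (W : Subgroup (V ≃ₗᵢ[ℝ] V)) [Finite W]
    (a : Fin ℓ → ℕ) (b : MvPolynomial (Fin ℓ) (ParamField W)) : Prop :=
  b ∈ invariants (ParamField W) e W ∧ (∃ n, b.IsHomogeneous n) ∧
    ∀ d u, IsHomogeneousGenerators e W d u → IsCanonical e W u a b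

end Dunkl

end

/-! The invariant `b_a` is obtained by Gram–Schmidt orthogonalization of the monomials `u^a`, so the
essential point is that finite Gram matrices of these monomials are invertible over `ℂ(c)`. At `c =
0` the Dunkl operators become partial derivatives and the form becomes `∑ m! f_m g_m`. This is
positive definite on real polynomials but has isotropic vectors over `ℂ`, so generators with real
coefficients are taken. For them the Gram determinant is a polynomial in `c` with nonzero value at
`c = 0` (`gram_det_ne_zero`). Neither symmetry of the form nor commutativity of the Dunkl operators
is needed.

Real generators come from Chevalley's theorem, proved over any field containing `ℝ`
(`exists_homogeneous_generators`) and then extended from `ℝ` to `ℂ`.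

Polynomials of different degrees are orthogonal, so only the finitely many lower monomials of the
same degree as `u^a` enter the linear system for `b_a` (`exists_isCanonical`). Two solutions with
the same leading coefficient differ by a combination of lower monomials orthogonal to all of these,
hence by zero (`eq_zero_of_orthogonal`).

Distinct degrees make the conditions independent of the generators. A monomial of degree `d_i` is
either `u_i` or involves only `u_j` with `j < i`, so a change of generators is triangular for `≺`
with nonzero complex diagonal entries (`exists_leading_ne_zero`). It preserves each lower span and
the form of the leading term. -/

noncomputable section

/-! ### Action on polynomials, averaging over `W`, divided differences. -/

namespace Dunkl

open MvPolynomial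

variable (K : Type*) [Field K] [Algebra ℝ K] {V : Type*} [NormedAddCommGroup V]
    [InnerProductSpace ℝ V] {ℓ : ℕ} (e : OrthonormalBasis (Fin ℓ) ℝ V)

theorem act_lin (w : V ≃ₗᵢ[ℝ] V) (v : V) : act K e w (lin K e v) = lin K e (w v) := by
  have h : w v = ∑ i, e.repr v i • w (e i) := by
    conv_lhs => rw [← e.sum_repr v]
    simp
  rw [h]
  have hlin : ∀ (s : Finset (Fin ℓ)), lin K e (∑ i ∈ s, e.repr v i • w (e i)) =
      ∑ i ∈ s, C (algebraMap ℝ K (e.repr v i)) * lin K e (w (e i)) := by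
    classical
    intro s
    induction s using Finset.induction_on with
    | empty => simp [lin]
    | insert i s hi ih => rw [Finset.sum_insert hi, Finset.sum_insert hi, add_comm, lin_add_smul,
        ih, add_comm]
  rw [hlin]
  simp [lin, act, algebraMap_eq]

theorem act_mul_apply (w₁ w₂ : V ≃ₗᵢ[ℝ] V) (f : MvPolynomial (Fin ℓ) K) :
    act K e (w₁ * w₂) f = act K e w₁ (act K e w₂ f) := by
  have : act K e (w₁ * w₂) = (act K e w₁).comp (act K e w₂) := by
    refine algHom_ext fun i => ?_
    rw [AlgHom.comp_apply, ← lin_basis K e i, act_lin, act_lin, act_lin]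
    rfl
  rw [this, AlgHom.comp_apply]

theorem act_one_apply (f : MvPolynomial (Fin ℓ) K) : act K e 1 f = f := by
  have : act K e 1 = AlgHom.id K _ := by
    refine algHom_ext fun i => ?_
    rw [← lin_basis K e i, act_lin]
    rfl
  rw [this, AlgHom.id_apply]

theorem isHomogeneous_lin (v : V) : (lin K e v).IsHomogeneous 1 :=
  IsHomogeneous.sum _ _ _ fun _ _ => isHomogeneous_C_mul_X _ _

theorem _root_.MvPolynomial.IsHomogeneous.act {f : MvPolynomial (Fin ℓ) K} {n : ℕ}
    (hf : f.IsHomogeneous n) (w : V ≃ₗᵢ[ℝ] V) : (act K e w f).IsHomogeneous n := by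
  have := hf.aeval (fun i => lin K e (w (e i))) (n := 1) (fun i => isHomogeneous_lin K e _)
  rwa [one_mul] at this

theorem _root_.MvPolynomial.IsHomogeneous.homogeneousComponent {σ R : Type*} [CommSemiring R]
    {f : MvPolynomial σ R} {m : ℕ} (hf : f.IsHomogeneous m) (n : ℕ) :
    homogeneousComponent n f = if n = m then f else 0 :=
  homogeneousComponent_of_mem hf

theorem homogeneousComponent_act (w : V ≃ₗᵢ[ℝ] V) (n : ℕ) (f : MvPolynomial (Fin ℓ) K) :
    homogeneousComponent n (act K e w f) = act K e w (homogeneousComponent n f) := by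
  conv_lhs => rw [← sum_homogeneousComponent f]
  rw [map_sum, map_sum]
  rw [Finset.sum_congr rfl fun i _ =>
    ((homogeneousComponent_isHomogeneous i f).act K e w).homogeneousComponent n]
  rw [Finset.sum_ite_eq]
  split_ifs with h
  · rfl
  · rw [homogeneousComponent_eq_zero, map_zero]
    simpa using h

theorem constantCoeff_act (w : V ≃ₗᵢ[ℝ] V) (f : MvPolynomial (Fin ℓ) K) :
    constantCoeff (act K e w f) = constantCoeff f := by
  have : (aeval (R := K) (0 : Fin ℓ → K)).comp (act K e w) = aeval (0 : Fin ℓ → K) := by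
    refine algHom_ext fun i => ?_
    simp [act, lin]
  have h := DFunLike.congr_fun this f
  simpa [aeval_zero] using h

/-- The average of a polynomial over `W`. -/
def average (W : Subgroup (V ≃ₗᵢ[ℝ] V)) [Fintype W] : Module.End K (MvPolynomial (Fin ℓ) K) :=
  (Fintype.card W : K)⁻¹ • ∑ w : W, (act K e (w : V ≃ₗᵢ[ℝ] V)).toLinearMap

variable (W : Subgroup (V ≃ₗᵢ[ℝ] V))

theorem homogeneousComponent_mem_invariants {f : MvPolynomial (Fin ℓ) K}
    (hf : f ∈ invariants K e W) (n : ℕ) : homogeneousComponent n f ∈ invariants K e W :=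
  fun w hw => by rw [← homogeneousComponent_act, hf w hw]

section

variable [Fintype W]

theorem average_apply (f : MvPolynomial (Fin ℓ) K) :
    average K e W f = (Fintype.card W : K)⁻¹ • ∑ w : W, act K e (w : V ≃ₗᵢ[ℝ] V) f := by
  simp [average]

theorem average_mem (f : MvPolynomial (Fin ℓ) K) : average K e W f ∈ invariants K e W := by
  intro w hw
  have h : ∑ w' : W, act K e w (act K e (w' : V ≃ₗᵢ[ℝ] V) f) =
      ∑ w' : W, act K e (w' : V ≃ₗᵢ[ℝ] V) f := by
    rw [← Equiv.sum_comp (Equiv.mulLeft (⟨w, hw⟩ : W)) fun w' : W => act K e (w' : V ≃ₗᵢ[ℝ] V) f]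
    refine Finset.sum_congr rfl fun w' _ => ?_
    rw [← act_mul_apply, Equiv.coe_mulLeft, Subgroup.coe_mul]
  rw [average_apply, map_smul, map_sum, h]

theorem average_mul {r : MvPolynomial (Fin ℓ) K} (hr : r ∈ invariants K e W)
    (f : MvPolynomial (Fin ℓ) K) : average K e W (r * f) = r * average K e W f := by
  rw [average_apply, average_apply, mul_smul_comm, Finset.mul_sum]
  congr 1
  exact Finset.sum_congr rfl fun w _ => by rw [map_mul, hr w w.2]

theorem card_ne_zero : (Fintype.card W : K) ≠ 0 := by
  have := charZero_of_injective_algebraMap (algebraMap ℝ K).injective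
  exact_mod_cast Fintype.card_ne_zero

theorem average_eq_self {f : MvPolynomial (Fin ℓ) K} (hf : f ∈ invariants K e W) :
    average K e W f = f := by
  rw [average_apply, Finset.sum_congr rfl fun (w : W) _ => hf w w.2, Finset.sum_const, Finset.card_univ,
    ← Nat.cast_smul_eq_nsmul K, smul_smul, inv_mul_cancel₀ (card_ne_zero K W), one_smul]

theorem constantCoeff_average (f : MvPolynomial (Fin ℓ) K) :
    constantCoeff (average K e W f) = constantCoeff f := by
  rw [average_apply, constantCoeff_smul, map_sum]
  simp_rw [constantCoeff_act]
  rw [Finset.sum_const, Finset.card_univ,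
    ← Nat.cast_smul_eq_nsmul K, smul_smul, inv_mul_cancel₀ (card_ne_zero K W), one_smul]

theorem sub_average_mem (I : Ideal (MvPolynomial (Fin ℓ) K)) (f : MvPolynomial (Fin ℓ) K)
    (h : ∀ w ∈ W, f - act K e w f ∈ I) : f - average K e W f ∈ I := by
  have : f - average K e W f =
      C (Fintype.card W : K)⁻¹ * ∑ w : W, (f - act K e (w : V ≃ₗᵢ[ℝ] V) f) := by
    rw [average_apply, Finset.sum_sub_distrib, Finset.sum_const, Finset.card_univ, mul_sub,
      ← Nat.cast_smul_eq_nsmul K, ← smul_eq_C_mul, ← smul_eq_C_mul, smul_smul,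
      inv_mul_cancel₀ (card_ne_zero K W), one_smul]
  rw [this]
  exact I.mul_mem_left _ (I.sum_mem fun w _ => h w w.2)

end

variable {W}

theorem lin_root_mul_inj (s : Refl W) {f g : MvPolynomial (Fin ℓ) K}
    (h : lin K e (root s) * f = lin K e (root s) * g) : f = g :=
  mul_left_cancel₀ (lin_ne_zero K e (root_ne_zero s)) h

theorem _root_.MvPolynomial.homogeneousComponent_mul_of_isHomogeneous
    {σ R : Type*} [CommSemiring R] {a : MvPolynomial σ R} {k : ℕ} (ha : a.IsHomogeneous k) (n : ℕ)
    (f : MvPolynomial σ R) :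
    homogeneousComponent (n + k) (a * f) = a * homogeneousComponent n f := by
  conv_lhs => rw [← sum_homogeneousComponent f]
  rw [Finset.mul_sum, map_sum]
  rw [Finset.sum_congr rfl fun i _ =>
    (ha.mul (homogeneousComponent_isHomogeneous i f)).homogeneousComponent (n + k)]
  rw [Finset.sum_congr rfl fun i _ => show _ = if n = i then a * homogeneousComponent i f else 0 by
    congr 1; simp only [eq_iff_iff]; omega]
  rw [Finset.sum_ite_eq]
  split_ifs with h
  · rfl
  · rw [homogeneousComponent_eq_zero, mul_zero]
    simpa using h

/-- The divisor `lin K e (root s)` has degree one, so divided differences lower degrees by one. This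
drives the induction in Chevalley's argument and gives the grading of the form. -/
theorem homogeneousComponent_divDiff (s : Refl W) (n : ℕ) (f : MvPolynomial (Fin ℓ) K) :
    homogeneousComponent n (divDiff K e s f) = divDiff K e s (homogeneousComponent (n + 1) f) := by
  apply lin_root_mul_inj K e s
  rw [← homogeneousComponent_mul_of_isHomogeneous (isHomogeneous_lin K e _),
    lin_root_mul_divDiff, lin_root_mul_divDiff, map_sub, homogeneousComponent_act]

theorem divDiff_mul {r : MvPolynomial (Fin ℓ) K} (hr : r ∈ invariants K e W) (s : Refl W)
    (f : MvPolynomial (Fin ℓ) K) : divDiff K e s (r * f) = r * divDiff K e s f := by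
  apply lin_root_mul_inj K e s
  rw [lin_root_mul_divDiff, mul_left_comm, lin_root_mul_divDiff, map_mul, hr s.1 s.1.2, mul_sub]

end Dunkl
end

/-! ### Algebraic independence from linear independence modulo decomposables. -/

noncomputable section

namespace Dunkl

open MvPolynomial

theorem _root_.MvPolynomial.pderiv_aeval {ι σ R : Type*} [CommRing R] [Fintype ι]
    (f : ι → MvPolynomial σ R) (h : MvPolynomial ι R) (k : σ) :
    pderiv k (aeval f h) = ∑ i, aeval f (pderiv i h) * pderiv k (f i) := by
  classical
  induction h using MvPolynomial.induction_on with
  | C a => simp [algebraMap_eq]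
  | add p q hp hq => simp only [map_add, hp, hq, add_mul, Finset.sum_add_distrib]
  | mul_X p j hp =>
    simp only [map_mul, aeval_X, pderiv_mul, hp, pderiv_X, map_add, add_mul,
      Finset.sum_add_distrib, Finset.sum_mul, Pi.single_apply]
    congr 1
    · exact Finset.sum_congr rfl fun i _ => by ring
    · rw [Finset.sum_eq_single j]
      · simp
      · intro i _ hi
        simp [hi.symm]
      · simp

theorem _root_.MvPolynomial.totalDegree_pderiv_lt {σ R : Type*} [CommRing R]
    (h : MvPolynomial σ R) (hh : 0 < h.totalDegree) (i : σ) :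
    (pderiv i h).totalDegree < h.totalDegree := by
  classical
  rw [totalDegree, Finset.sup_lt_iff hh]
  intro m hm
  rw [mem_support_iff, coeff_pderiv] at hm
  have h1 := le_totalDegree (mem_support_iff.2 (left_ne_zero_of_mul hm))
  rw [Finsupp.sum_add_index' (by simp) (by simp), Finsupp.sum_single_index rfl] at h1
  omega

theorem _root_.MvPolynomial.eq_C_of_pderiv_eq_zero {σ R : Type*} [Field R] [CharZero R]
    (h : MvPolynomial σ R) (hh : ∀ i, pderiv i h = 0) : h = C (constantCoeff h) := by
  classical
  ext m
  rw [coeff_C]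
  split_ifs with hm
  · rw [← hm]
    rfl
  · obtain ⟨i, hi⟩ : ∃ i, m i ≠ 0 := by
      by_contra! H
      exact hm (Finsupp.ext fun i => (H i).symm)
    have h1 := congrArg (coeff (m - Finsupp.single i 1)) (hh i)
    rw [coeff_pderiv, tsub_add_cancel_of_le (by simpa [Nat.one_le_iff_ne_zero] using hi),
      coeff_zero, mul_eq_zero] at h1
    exact h1.resolve_right (Nat.cast_add_one_ne_zero _)

variable (K : Type*) [Field K] [Algebra ℝ K] {V : Type*} [NormedAddCommGroup V]
    [InnerProductSpace ℝ V] {ℓ : ℕ} (e : OrthonormalBasis (Fin ℓ) ℝ V)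
    (W : Subgroup (V ≃ₗᵢ[ℝ] V))

/-- The invariants without constant term. -/
def augmentation : Set (MvPolynomial (Fin ℓ) K) :=
  {p | p ∈ invariants K e W ∧ constantCoeff p = 0}

/-- The ideal generated by the invariants without constant term. -/
def hilbertIdeal : Ideal (MvPolynomial (Fin ℓ) K) :=
  Ideal.span (augmentation K e W)

/-- The span of the products of two invariants without constant term. -/
def decomposables : Submodule K (MvPolynomial (Fin ℓ) K) :=
  Submodule.span K {f | ∃ p ∈ augmentation K e W, ∃ q ∈ augmentation K e W, f = p * q}

variable {W} {K e}

theorem act_mem_hilbertIdeal {w : V ≃ₗᵢ[ℝ] V} (hw : w ∈ W) {f : MvPolynomial (Fin ℓ) K}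
    (hf : f ∈ hilbertIdeal K e W) : act K e w f ∈ hilbertIdeal K e W := by
  have : hilbertIdeal K e W ≤ (hilbertIdeal K e W).comap (act K e w) := by
    refine Ideal.span_le.2 fun p hp => ?_
    rw [SetLike.mem_coe, Ideal.mem_comap, hp.1 w hw]
    exact Ideal.subset_span hp
  exact this hf

/-- Averaging is linear over invariants: for `g = a * p` with `p` invariant, the average of `x * g`
is `p` times the average of `x * a`, whose constant term is still zero. -/
theorem average_mul_mem_decomposables [Fintype W] {g : MvPolynomial (Fin ℓ) K}
    (hg : g ∈ hilbertIdeal K e W) :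
    ∀ x, constantCoeff x = 0 → average K e W (x * g) ∈ decomposables K e W := by
  induction hg using Submodule.span_induction with
  | mem p hp =>
    intro x hx
    rw [mul_comm, average_mul K e W hp.1]
    refine Submodule.subset_span ⟨p, hp, _, ⟨average_mem K e W x, ?_⟩, rfl⟩
    rw [constantCoeff_average, hx]
  | zero => simp
  | add p q _ _ hp hq =>
    intro x hx
    rw [mul_add, map_add]
    exact add_mem (hp x hx) (hq x hx)
  | smul a p _ hp =>
    intro x hx
    rw [smul_eq_mul, ← mul_assoc]
    exact hp _ (by simp [hx])

/-- The ideal is `W`-stable, so congruences for the generating reflections propagate through `G -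
w₁w₂G = (G - w₁G) + w₁(G - w₂G)`. -/
theorem sub_act_mem_hilbertIdeal
    (hW : Subgroup.closure {s | s ∈ W ∧ IsReflection s} = W) {G : MvPolynomial (Fin ℓ) K}
    (hG : ∀ s : Refl W, G - act K e s.1 G ∈ hilbertIdeal K e W) {w : V ≃ₗᵢ[ℝ] V} (hw : w ∈ W) :
    G - act K e w G ∈ hilbertIdeal K e W := by
  rw [← hW] at hw
  induction hw using Subgroup.closure_induction with
  | mem s hs => exact hG ⟨⟨s, hs.1⟩, hs.2⟩
  | one => simp [act_one_apply]
  | mul w₁ w₂ h₁ h₂ ih₁ ih₂ =>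
    rw [hW] at h₁
    rw [act_mul_apply, ← sub_add_sub_cancel G (act K e w₁ G), ← map_sub]
    exact add_mem ih₁ (act_mem_hilbertIdeal h₁ ih₂)
  | inv w h ih =>
    rw [hW] at h
    have := act_mem_hilbertIdeal (inv_mem h) ih
    rw [map_sub, ← act_mul_apply, inv_mul_cancel, act_one_apply] at this
    rw [← neg_sub]
    exact neg_mem this

/-- Chevalley's syzygy lemma, with a functional `φ` that sees only the constant terms of the
cofactors of the `h i`. Divided differences are linear over invariants, so they carry the relation
to one with cofactors of lower degree; by induction `G` is congruent to each `sG`, hence to its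
average. The average is invariant, and its constant term is `φ` of the averaged relation, that is,
zero. -/
theorem sum_C_mul_mem_hilbertIdeal [Finite W]
    (hW : Subgroup.closure {s | s ∈ W ∧ IsReflection s} = W) {ι : Type*} [Fintype ι]
    (h : ι → MvPolynomial (Fin ℓ) K) (hh : ∀ i, h i ∈ invariants K e W)
    (φ : MvPolynomial (Fin ℓ) K →ₗ[K] K)
    (hφ : ∀ i, ∀ p, constantCoeff p = 0 → φ (h i * p) = 0) (n : ℕ) :
    ∀ g : ι → MvPolynomial (Fin ℓ) K, (∀ i m, n ≤ m → homogeneousComponent m (g i) = 0) →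
      ∑ i, h i * g i = 0 → ∑ i, C (φ (h i)) * g i ∈ hilbertIdeal K e W := by
  cases nonempty_fintype W
  induction n with
  | zero =>
    intro g hg _
    have : ∀ i, g i = 0 := fun i => by
      rw [← sum_homogeneousComponent (g i)]
      exact Finset.sum_eq_zero fun m _ => hg i m (Nat.zero_le _)
    simp [this]
  | succ n ih =>
    intro g hg hsum
    set G := ∑ i, C (φ (h i)) * g i with hG
    have hs : ∀ s : Refl W, G - act K e s.1 G ∈ hilbertIdeal K e W := by
      intro s
      have h1 := ih (fun i => divDiff K e s (g i))
        (fun i m hm => by rw [homogeneousComponent_divDiff, hg i (m + 1) (by omega), map_zero])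
        (by simp_rw [← divDiff_mul K e (hh _)]; rw [← map_sum, hsum, map_zero])
      have h2 : G - act K e s.1 G =
          lin K e (root s) * ∑ i, C (φ (h i)) * divDiff K e s (g i) := by
        rw [← lin_root_mul_divDiff, hG, map_sum]
        congr 1
        refine Finset.sum_congr rfl fun i _ => ?_
        rw [← smul_eq_C_mul, map_smul, smul_eq_C_mul]
      rw [h2]
      exact Ideal.mul_mem_left _ _ h1
    have h3 := sub_average_mem K e W _ G fun w hw => sub_act_mem_hilbertIdeal hW hs hw
    have h4 : average K e W G ∈ hilbertIdeal K e W := by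
      refine Ideal.subset_span ⟨average_mem K e W G, ?_⟩
      rw [constantCoeff_average, hG, map_sum]
      have h5 : ∑ i, h i * average K e W (g i) = 0 := by
        simp_rw [← average_mul K e W (hh _)]
        rw [← map_sum, hsum, map_zero]
      have h6 : ∀ i, φ (h i * average K e W (g i)) = φ (h i) * constantCoeff (g i) := by
        intro i
        have h7 := hφ i (average K e W (g i) - C (constantCoeff (g i)))
          (by rw [map_sub, constantCoeff_average, constantCoeff_C, sub_self])
        rw [mul_sub, map_sub, sub_eq_zero, mul_comm _ (C _), ← smul_eq_C_mul, map_smul,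
          smul_eq_mul, mul_comm (constantCoeff _)] at h7
        exact h7
      have h8 := congrArg φ h5
      rw [map_sum, map_zero, Finset.sum_congr rfl fun i _ => h6 i] at h8
      simpa using h8
    simpa using add_mem h3 h4

/-- A nonzero relation `h` of least degree has some `∂h/∂f_i` nonzero at `f`. Differentiating the
relation in `X k` gives a syzygy with invariant coefficients `H i`. The syzygy lemma and Euler's
identity turn it into a linear dependence of the `f i` modulo decomposables. -/
theorem algebraicIndependent_of_linearIndependent [Finite W]
    (hW : Subgroup.closure {s | s ∈ W ∧ IsReflection s} = W) {ι : Type*} [Finite ι]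
    (f : ι → MvPolynomial (Fin ℓ) K) (hf : ∀ i, f i ∈ invariants K e W) (d : ι → ℕ)
    (hd : ∀ i, 0 < d i) (hfd : ∀ i, (f i).IsHomogeneous (d i))
    (hli : LinearIndependent K fun i => (decomposables K e W).mkQ (f i)) :
    AlgebraicIndependent K f := by
  cases nonempty_fintype W
  cases nonempty_fintype ι
  have := charZero_of_injective_algebraMap (algebraMap ℝ K).injective
  have key : ∀ n, ∀ h : MvPolynomial ι K, h.totalDegree = n → aeval f h = 0 → h = 0 := by
    intro n
    induction n using Nat.strong_induction_on with
    | _ n ih =>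
    intro h hn h0
    by_cases hH : ∀ i, aeval f (pderiv i h) = 0
    · have hC : h = C (constantCoeff h) := by
        rcases Nat.eq_zero_or_pos n with h1 | h1
        · rw [h1, totalDegree_eq_zero_iff_eq_C] at hn
          exact hn
        · exact eq_C_of_pderiv_eq_zero h fun i =>
            ih _ (hn ▸ totalDegree_pderiv_lt h (hn ▸ h1) i) _ rfl (hH i)
      rw [hC, aeval_C, algebraMap_eq, C_eq_zero] at h0
      rw [hC, h0, C_0]
    exfalso
    push Not at hH
    obtain ⟨i₁, hi₁⟩ := hH
    set H : ι → MvPolynomial (Fin ℓ) K := fun i => aeval f (pderiv i h) with hHdef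
    have hHinv : ∀ i, H i ∈ invariants K e W := fun i => by
      have h1 : H i ∈ Algebra.adjoin K (Set.range f) := by
        rw [Algebra.adjoin_range_eq_range_aeval]
        exact ⟨_, rfl⟩
      exact Algebra.adjoin_le (S := invariants K e W) (by rintro _ ⟨j, rfl⟩; exact hf j) h1
    have hex : ∃ n, ∃ i m, m.degree = n ∧ coeff m (H i) ≠ 0 := by
      obtain ⟨m, hm⟩ := MvPolynomial.ne_zero_iff.1 hi₁
      exact ⟨_, i₁, m, rfl, hm⟩
    classical
    -- `m` has least degree among the monomials of all the `H i`, so its coefficient in `H i * p`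
    -- vanishes when `p` has no constant term; `lcoeff K m` is the functional required by the syzygy
    -- lemma.
    obtain ⟨i₀, m, hm, hm0⟩ := Nat.find_spec hex
    have hmin : ∀ i a, a.degree < m.degree → coeff a (H i) = 0 := by
      intro i a ha
      by_contra hne
      exact Nat.find_min hex (hm ▸ ha) ⟨i, a, rfl, hne⟩
    have hlam : ∀ i, ∀ p, constantCoeff p = 0 → lcoeff K m (H i * p) = 0 := by
      intro i p hp
      rw [lcoeff_apply, coeff_mul]
      refine Finset.sum_eq_zero fun x hx => ?_
      rw [Finset.HasAntidiagonal.mem_antidiagonal] at hx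
      by_cases h2 : x.2 = 0
      · rw [h2, ← constantCoeff_eq, hp, mul_zero]
      · rw [hmin i x.1, zero_mul]
        rw [← hx, map_add]
        have : x.2.degree ≠ 0 := by simpa [Finsupp.degree_eq_zero_iff] using h2
        omega
    have hG : ∀ k, ∑ i, C (lcoeff K m (H i)) * pderiv k (f i) ∈ hilbertIdeal K e W := by
      intro k
      refine sum_C_mul_mem_hilbertIdeal hW H hHinv _ hlam
        (Finset.univ.sup (fun i => (pderiv k (f i)).totalDegree) + 1) _ ?_ ?_
      · intro i a ha
        refine homogeneousComponent_eq_zero _ _ (lt_of_lt_of_le (Nat.lt_succ_of_le ?_) ha)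
        exact Finset.le_sup (f := fun i => (pderiv k (f i)).totalDegree) (Finset.mem_univ i)
      · rw [← pderiv_aeval, h0, map_zero]
    -- Euler's identity `∑ X k * ∂_k f_i = d_i f_i`; the factors `X k` without constant term then
    -- make the average decomposable.
    have hE : ∑ i, (coeff m (H i) * (d i : K)) • f i =
        ∑ k, X k * ∑ i, C (lcoeff K m (H i)) * pderiv k (f i) := by
      simp_rw [Finset.mul_sum]
      rw [Finset.sum_comm]
      refine Finset.sum_congr rfl fun i _ => ?_
      simp_rw [mul_left_comm (X _)]
      rw [← Finset.mul_sum, (hfd i).sum_X_mul_pderiv, lcoeff_apply, ← smul_eq_C_mul, mul_smul,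
        Nat.cast_smul_eq_nsmul]
    have hQ : ∑ i, (coeff m (H i) * (d i : K)) • f i ∈ decomposables K e W := by
      rw [← average_eq_self K e W (f := ∑ i, (coeff m (H i) * (d i : K)) • f i)
        (sum_mem fun i _ => Subalgebra.smul_mem _ (hf i) _), hE, map_sum]
      exact sum_mem fun k _ => average_mul_mem_decomposables (hG k) _ (by simp)
    rw [← Submodule.Quotient.mk_eq_zero, ← Submodule.mkQ_apply, map_sum] at hQ
    simp_rw [map_smul] at hQ
    have h9 := Fintype.linearIndependent_iff.1 hli _ hQ i₀
    rw [mul_eq_zero] at h9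
    rcases h9 with h9 | h9
    · exact hm0 h9
    · exact (hd i₀).ne' (by exact_mod_cast h9)
  exact (injective_iff_map_eq_zero _).2 fun h h0 => key _ h rfl h0

end Dunkl
end

/-! ### Chevalley's theorem. -/

noncomputable section

namespace Dunkl

open MvPolynomial

variable {K : Type*} [Field K] [Algebra ℝ K] {V : Type*} [NormedAddCommGroup V]
    [InnerProductSpace ℝ V] {ℓ : ℕ} {e : OrthonormalBasis (Fin ℓ) ℝ V}
    {W : Subgroup (V ≃ₗᵢ[ℝ] V)}

/-- Induction on the degree: a decomposable of degree `n` is a sum of products of invariants of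
degree below `n`, already in the subalgebra. -/
theorem invariants_eq_adjoin {κ : Type*} (f : κ → MvPolynomial (Fin ℓ) K)
    (hf : ∀ i, f i ∈ invariants K e W) (d : κ → ℕ) (hfd : ∀ i, (f i).IsHomogeneous (d i))
    (hspan : ∀ y ∈ invariants K e W, ∀ n, 0 < n → y.IsHomogeneous n →
      y ∈ Submodule.span K (Set.range f) ⊔ decomposables K e W) :
    Algebra.adjoin K (Set.range f) = invariants K e W := by
  refine le_antisymm (Algebra.adjoin_le (by rintro _ ⟨j, rfl⟩; exact hf j)) ?_
  have key : ∀ n, ∀ y ∈ invariants K e W, y.IsHomogeneous n →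
      y ∈ Algebra.adjoin K (Set.range f) := by
    intro n
    induction n using Nat.strong_induction_on with
    | _ n ih =>
    intro y hy hyn
    rcases Nat.eq_zero_or_pos n with h1 | h1
    · subst h1
      rw [← totalDegree_zero_iff_isHomogeneous, totalDegree_eq_zero_iff_eq_C] at hyn
      rw [hyn]
      exact Subalgebra.algebraMap_mem _ _
    · obtain ⟨y₁, hy₁, y₂, hy₂, hsum⟩ := Submodule.mem_sup.1 (hspan y hy n h1 hyn)
      rw [← homogeneousComponent_eq_self hyn, ← hsum, map_add]
      have h₁ : Submodule.span K (Set.range f) ≤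
          (Algebra.adjoin K (Set.range f)).toSubmodule.comap (homogeneousComponent n) := by
        rw [Submodule.span_le]
        rintro _ ⟨j, rfl⟩
        simp only [SetLike.mem_coe, Submodule.mem_comap, (hfd j).homogeneousComponent]
        split_ifs
        · exact Algebra.subset_adjoin ⟨j, rfl⟩
        · exact zero_mem _
      have h₂ : decomposables K e W ≤
          (Algebra.adjoin K (Set.range f)).toSubmodule.comap (homogeneousComponent n) := by
        refine Submodule.span_le.2 ?_
        rintro _ ⟨p, hp, q, hq, rfl⟩
        rw [SetLike.mem_coe, Submodule.mem_comap, ← sum_homogeneousComponent p,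
          ← sum_homogeneousComponent q, Finset.sum_mul_sum, map_sum]
        refine sum_mem fun i _ => ?_
        rw [map_sum]
        refine sum_mem fun j _ => ?_
        rw [((homogeneousComponent_isHomogeneous i p).mul
          (homogeneousComponent_isHomogeneous j q)).homogeneousComponent]
        split_ifs with hij
        -- Components of degree zero vanish in both factors, so `i` and `j` are both smaller than
        -- `n`.
        · rcases Nat.eq_zero_or_pos i with rfl | hi
          · rw [homogeneousComponent_zero, ← constantCoeff_eq, hp.2, C_0, zero_mul]
            exact zero_mem _
          rcases Nat.eq_zero_or_pos j with rfl | hj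
          · rw [homogeneousComponent_zero, ← constantCoeff_eq, hq.2, C_0, mul_zero]
            exact zero_mem _
          exact Subalgebra.mul_mem (Algebra.adjoin K (Set.range f))
            (ih i (by omega) _ (homogeneousComponent_mem_invariants K e W hp.1 i)
              (homogeneousComponent_isHomogeneous i p))
            (ih j (by omega) _ (homogeneousComponent_mem_invariants K e W hq.1 j)
              (homogeneousComponent_isHomogeneous j q))
        · exact zero_mem _
      exact add_mem (h₁ hy₁) (h₂ hy₂)
  intro y hy
  rw [← sum_homogeneousComponent y]
  exact sum_mem fun n _ => key n _ (homogeneousComponent_mem_invariants K e W hy n)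
    (homogeneousComponent_isHomogeneous n y)

/-- The action of `W` on the polynomial ring by ring automorphisms. -/
@[reducible] def actMulSemiringAction (K : Type*) [Field K] [Algebra ℝ K]
    (e : OrthonormalBasis (Fin ℓ) ℝ V) (W : Subgroup (V ≃ₗᵢ[ℝ] V)) :
    MulSemiringAction W (MvPolynomial (Fin ℓ) K) where
  smul w f := act K e (w : V ≃ₗᵢ[ℝ] V) f
  one_smul f := act_one_apply K e f
  mul_smul w₁ w₂ f := act_mul_apply K e w₁ w₂ f
  smul_zero w := map_zero (act K e (w : V ≃ₗᵢ[ℝ] V))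
  smul_add w := map_add (act K e (w : V ≃ₗᵢ[ℝ] V))
  smul_one w := map_one (act K e (w : V ≃ₗᵢ[ℝ] V))
  smul_mul w := map_mul (act K e (w : V ≃ₗᵢ[ℝ] V))

theorem isIntegral_invariants [Finite W] :
    Algebra.IsIntegral (invariants K e W) (MvPolynomial (Fin ℓ) K) := by
  let _ := actMulSemiringAction K e W
  have : Algebra.IsInvariant (invariants K e W) (MvPolynomial (Fin ℓ) K) W :=
    ⟨fun b hb => ⟨⟨b, fun w hw => hb ⟨w, hw⟩⟩, rfl⟩⟩
  exact Algebra.IsInvariant.isIntegral (invariants K e W) (MvPolynomial (Fin ℓ) K) W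

/-- The polynomial ring is integral over the invariants, so `f` is a transcendence basis, like the
`ℓ` variables. -/
theorem nonempty_equiv_of_adjoin_eq_invariants [Finite W] {κ : Type*}
    {f : κ → MvPolynomial (Fin ℓ) K} (hind : AlgebraicIndependent K f)
    (hgen : Algebra.adjoin K (Set.range f) = invariants K e W) : Nonempty (Fin ℓ ≃ κ) := by
  have hint := isIntegral_invariants (K := K) (e := e) (W := W)
  have halg : Algebra.IsAlgebraic (Algebra.adjoin K (Set.range f)) (MvPolynomial (Fin ℓ) K) := by
    rw [hgen]
    exact Algebra.IsIntegral.isAlgebraic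
  have hb := hind.isTranscendenceBasis_iff_isAlgebraic.2 halg
  have := (IsTranscendenceBasis.mvPolynomial (Fin ℓ) K).lift_cardinalMk_eq hb
  exact Cardinal.lift_mk_eq'.1 this

/-- **Chevalley's theorem**: the invariants of a finite reflection group form a polynomial
algebra with homogeneous generators. -/
theorem exists_homogeneous_generators [Finite W]
    (hW : Subgroup.closure {s | s ∈ W ∧ IsReflection s} = W) :
    ∃ (d : Fin ℓ → ℕ) (u : Fin ℓ → MvPolynomial (Fin ℓ) K), (∀ i, (u i).IsHomogeneous (d i)) ∧
      Monotone d ∧ AlgebraicIndependent K u ∧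
      Algebra.adjoin K (Set.range u) = invariants K e W := by
  let Y : Type _ := {p : MvPolynomial (Fin ℓ) K //
    p ∈ invariants K e W ∧ ∃ n, 0 < n ∧ p.IsHomogeneous n}
  -- The generators represent a basis of the span of positive-degree homogeneous invariants modulo
  -- decomposables. The index type `κ` may a priori be infinite; independence is checked on finite
  -- subsets, and the transcendence degree identifies `κ` with `Fin ℓ` afterwards.
  obtain ⟨κ, a, -, hspan, hli⟩ := exists_linearIndependent' K
    fun y : Y => (decomposables K e W).mkQ y.1
  let f : κ → MvPolynomial (Fin ℓ) K := fun k => (a k).1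
  have hf : ∀ k, f k ∈ invariants K e W := fun k => (a k).2.1
  choose d hd hfd using fun k => (a k).2.2
  have hind : AlgebraicIndependent K f := algebraicIndependent_of_finite_type fun t ht => by
    have := ht.to_subtype
    exact algebraicIndependent_of_linearIndependent hW _ (fun i => hf i) (fun i => d i)
      (fun i => hd i) (fun i => hfd i) (hli.comp _ Subtype.val_injective)
  have hgen : Algebra.adjoin K (Set.range f) = invariants K e W := by
    refine invariants_eq_adjoin f hf d hfd fun y hy n hn hyn => ?_
    have h1 : (decomposables K e W).mkQ y ∈
        Submodule.span K (Set.range ((decomposables K e W).mkQ ∘ f)) := by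
      have h2 : (decomposables K e W).mkQ y ∈ Submodule.span K
          (Set.range fun y : Y => (decomposables K e W).mkQ y.1) :=
        Submodule.subset_span ⟨⟨y, hy, n, hn, hyn⟩, rfl⟩
      rw [← hspan] at h2
      exact h2
    rw [Set.range_comp, Submodule.span_image, ← Submodule.mem_comap, Submodule.comap_map_mkQ,
      sup_comm] at h1
    exact h1
  obtain ⟨E⟩ := nonempty_equiv_of_adjoin_eq_invariants hind hgen
  let σ := Tuple.sort (d ∘ E)
  refine ⟨fun i => d (E (σ i)), fun i => f (E (σ i)), fun i => hfd _,
    Tuple.monotone_sort (d ∘ E), hind.comp _ (E.injective.comp σ.injective), ?_⟩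
  rw [← hgen]
  congr 1
  exact ((σ.trans E).surjective.range_comp f)

end Dunkl
end

/-! ### Monomials in generators, and extension of scalars. -/

noncomputable section

namespace Dunkl

open MvPolynomial

theorem _root_.AlgebraicIndependent.linearIndependent_prod_pow {ι R A : Type*} [Fintype ι]
    [CommRing R] [CommRing A] [Algebra R A] {u : ι → A} (hu : AlgebraicIndependent R u) :
    LinearIndependent R fun a : ι → ℕ => ∏ i, u i ^ a i := by
  have h1 := ((basisMonomials ι R).linearIndependent.map' (aeval u).toLinearMap
    (LinearMap.ker_eq_bot.2 hu)).comp _ Finsupp.equivFunOnFinite.symm.injective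
  have h2 : (fun a : ι → ℕ => ∏ i, u i ^ a i) = ((aeval u).toLinearMap ∘ basisMonomials ι R) ∘
      Finsupp.equivFunOnFinite.symm := by
    funext a
    simp [aeval_monomial, Finsupp.prod_fintype]
  rw [h2]
  exact h1

theorem _root_.algebraicIndependent_of_linearIndependent_prod_pow {ι R A : Type*} [Fintype ι]
    [CommRing R] [CommRing A] [Algebra R A] {u : ι → A}
    (hu : LinearIndependent R fun a : ι → ℕ => ∏ i, u i ^ a i) : AlgebraicIndependent R u := by
  refine (injective_iff_map_eq_zero _).2 fun p hp => ?_
  have h1 := hu.comp (fun m : ι →₀ ℕ => (m : ι → ℕ)) DFunLike.coe_injective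
  rw [aeval_def, eval₂_eq'] at hp
  have h2 := linearIndependent_iff'.1 h1 p.support (fun m => coeff m p)
    (by simpa [Algebra.smul_def] using hp)
  ext m
  by_cases hm : m ∈ p.support
  · simpa using h2 m hm
  · simpa using hm

/-- A `K`-linear functional on `L`, applied to the coefficients, turns a relation over `L` into one
over `K`; functionals separate the elements of `L`. -/
theorem _root_.LinearIndependent.map_mvPolynomial {ι σ K : Type*} (L : Type*) [Field K] [Field L]
    [Algebra K L] {v : ι → MvPolynomial σ K} (hv : LinearIndependent K v) :
    LinearIndependent L fun i => MvPolynomial.map (algebraMap K L) (v i) := by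
  rw [linearIndependent_iff'] at hv ⊢
  intro s g hg i hi
  rw [← Module.forall_dual_apply_eq_zero_iff K]
  intro φ
  refine hv s (fun i => φ (g i)) ?_ i hi
  ext m
  have h1 := congrArg φ (congrArg (coeff m) hg)
  simp only [coeff_sum, coeff_smul, coeff_map, coeff_zero, map_zero, map_sum, smul_eq_mul] at h1 ⊢
  rw [← h1]
  refine Finset.sum_congr rfl fun j _ => ?_
  rw [mul_comm (g j), ← Algebra.smul_def, map_smul, smul_eq_mul, mul_comm]

section BaseChange

variable {K : Type*} [Field K] [Algebra ℝ K] (L : Type*) [Field L] [Algebra ℝ L] [Algebra K L]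
    [IsScalarTower ℝ K L] {V : Type*} [NormedAddCommGroup V]
    [InnerProductSpace ℝ V] {ℓ : ℕ} {e : OrthonormalBasis (Fin ℓ) ℝ V}
    {W : Subgroup (V ≃ₗᵢ[ℝ] V)}

theorem map_lin (v : V) : map (algebraMap K L) (lin K e v) = lin L e v := by
  simp [lin, ← IsScalarTower.algebraMap_apply]

theorem map_act (w : V ≃ₗᵢ[ℝ] V) (f : MvPolynomial (Fin ℓ) K) :
    map (algebraMap K L) (act K e w f) = act L e w (map (algebraMap K L) f) := by
  induction f using MvPolynomial.induction_on with
  | C a => simp [act, algebraMap_eq]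
  | add p q hp hq => simp [hp, hq]
  | mul_X p i hp => simp only [map_mul, hp, ← lin_basis _ e, act_lin, map_lin]

theorem map_divDiff (s : Refl W) (f : MvPolynomial (Fin ℓ) K) :
    map (algebraMap K L) (divDiff K e s f) = divDiff L e s (map (algebraMap K L) f) := by
  apply lin_root_mul_inj L e s
  rw [lin_root_mul_divDiff, ← map_lin (K := K), ← map_mul, lin_root_mul_divDiff, map_sub, map_act]

theorem map_mem_invariants {f : MvPolynomial (Fin ℓ) K} (hf : f ∈ invariants K e W) :
    map (algebraMap K L) f ∈ invariants L e W :=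
  fun w hw => by rw [← map_act, hf w hw]

theorem map_average [Fintype W] (f : MvPolynomial (Fin ℓ) K) :
    map (algebraMap K L) (average K e W f) = average L e W (map (algebraMap K L) f) := by
  simp [average_apply, map_act, smul_eq_C_mul]

/-- An invariant over `L` equals its average, an `L`-combination of averages of monomials, and these
averages are defined over `K`. -/
theorem adjoin_map_eq_invariants [Finite W] {ι : Type*} {u : ι → MvPolynomial (Fin ℓ) K}
    (hu : Algebra.adjoin K (Set.range u) = invariants K e W) :
    Algebra.adjoin L (Set.range fun i => map (algebraMap K L) (u i)) = invariants L e W := by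
  cases nonempty_fintype W
  refine le_antisymm (Algebra.adjoin_le ?_) ?_
  · rintro _ ⟨j, rfl⟩
    refine map_mem_invariants L ?_
    rw [← hu]
    exact Algebra.subset_adjoin ⟨j, rfl⟩
  · have h1 : ∀ f ∈ Algebra.adjoin K (Set.range u), map (algebraMap K L) f ∈
        Algebra.adjoin L (Set.range fun i => map (algebraMap K L) (u i)) := by
      intro f hf
      induction hf using Algebra.adjoin_induction with
      | mem x hx =>
        obtain ⟨j, rfl⟩ := hx
        exact Algebra.subset_adjoin ⟨j, rfl⟩
      | algebraMap r =>
        rw [algebraMap_eq, map_C]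
        exact Subalgebra.algebraMap_mem _ _
      | add x y _ _ hx hy =>
        rw [map_add]
        exact add_mem hx hy
      | mul x y _ _ hx hy =>
        rw [map_mul]
        exact mul_mem hx hy
    intro f hf
    rw [← average_eq_self L e W hf, f.as_sum, map_sum]
    refine sum_mem fun m _ => ?_
    rw [← mul_one (coeff m f), ← smul_eq_mul, ← smul_monomial, map_smul]
    refine Subalgebra.smul_mem _ ?_ _
    have h2 := h1 (average K e W (monomial m 1)) (hu ▸ average_mem K e W _)
    rwa [map_average, map_monomial, map_one] at h2

end BaseChange

/-! ### Real generators and uniqueness of the degrees. -/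

section Generators

variable {V : Type*} [NormedAddCommGroup V] [InnerProductSpace ℝ V] {ℓ : ℕ}
    {e : OrthonormalBasis (Fin ℓ) ℝ V} {W : Subgroup (V ≃ₗᵢ[ℝ] V)}

theorem exists_real_generators [Finite W]
    (hW : Subgroup.closure {s | s ∈ W ∧ IsReflection s} = W) :
    ∃ (d : Fin ℓ → ℕ) (u : Fin ℓ → MvPolynomial (Fin ℓ) ℝ), AlgebraicIndependent ℝ u ∧
      IsHomogeneousGenerators e W d fun i => map (algebraMap ℝ ℂ) (u i) := by
  obtain ⟨d, u, hh, hm, hi, hg⟩ := exists_homogeneous_generators (K := ℝ) (e := e) hW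
  refine ⟨d, u, hi, fun i => (hh i).map _, hm, ?_, adjoin_map_eq_invariants ℂ hg⟩
  refine algebraicIndependent_of_linearIndependent_prod_pow ?_
  simpa using hi.linearIndependent_prod_pow.map_mvPolynomial ℂ

theorem isHomogeneous_prod_pow {σ R : Type*} [CommRing R] {d : Fin ℓ → ℕ}
    {u : Fin ℓ → MvPolynomial σ R} (hu : ∀ i, (u i).IsHomogeneous (d i)) (a : Fin ℓ → ℕ) :
    (∏ i, u i ^ a i).IsHomogeneous (∑ i, d i * a i) :=
  IsHomogeneous.prod _ _ _ fun i _ => (hu i).pow (a i)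

theorem mem_span_prod_pow_of_isHomogeneous {σ R : Type*} [CommRing R] {d : Fin ℓ → ℕ}
    {u : Fin ℓ → MvPolynomial σ R} (hu : ∀ i, (u i).IsHomogeneous (d i)) {y : MvPolynomial σ R}
    {n : ℕ} (hy : y ∈ Algebra.adjoin R (Set.range u)) (hyn : y.IsHomogeneous n) :
    y ∈ Submodule.span R {f | ∃ a : Fin ℓ → ℕ, ∑ i, d i * a i = n ∧ f = ∏ i, u i ^ a i} := by
  rw [Algebra.adjoin_range_eq_range_aeval] at hy
  obtain ⟨p, rfl⟩ := hy
  rw [← homogeneousComponent_eq_self hyn]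
  change homogeneousComponent n (aeval u p) ∈ _
  rw [aeval_def, eval₂_eq', map_sum]
  refine sum_mem fun m _ => ?_
  rw [← Algebra.smul_def, map_smul, (isHomogeneous_prod_pow hu m).homogeneousComponent]
  refine Submodule.smul_mem _ _ ?_
  split_ifs with h
  · exact Submodule.subset_span ⟨m, h.symm, rfl⟩
  · exact zero_mem _

namespace IsHomogeneousGenerators

variable {d d' : Fin ℓ → ℕ} {u u' : Fin ℓ → MvPolynomial (Fin ℓ) ℂ}

theorem degree_pos (hu : IsHomogeneousGenerators e W d u) (i : Fin ℓ) : 0 < d i := by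
  rw [Nat.pos_iff_ne_zero]
  intro h
  have h1 := hu.homogeneous i
  rw [h, ← totalDegree_zero_iff_isHomogeneous, totalDegree_eq_zero_iff_eq_C] at h1
  refine hu.algebraicIndependent.transcendental i ?_
  rw [h1]
  exact isAlgebraic_algebraMap _

theorem mem_invariants (hu : IsHomogeneousGenerators e W d u) (i : Fin ℓ) :
    u i ∈ invariants ℂ e W := by
  rw [← hu.generate]
  exact Algebra.subset_adjoin ⟨i, rfl⟩

/-- The `u' i` of degree at most `n` are independent elements of the algebra generated by the `u j`
of degree at most `n`; its transcendence degree bounds their number. -/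
theorem card_le (hu : IsHomogeneousGenerators e W d u) (hu' : IsHomogeneousGenerators e W d' u')
    (n : ℕ) : Fintype.card {i // d' i ≤ n} ≤ Fintype.card {i // d i ≤ n} := by
  let v : {i // d i ≤ n} → MvPolynomial (Fin ℓ) ℂ := fun i => u i
  have hmem : ∀ i : {i // d' i ≤ n}, u' i ∈ (aeval v : _ →ₐ[ℂ] MvPolynomial (Fin ℓ) ℂ).range := by
    intro i
    have h1 := mem_span_prod_pow_of_isHomogeneous hu.homogeneous
      (hu.generate ▸ hu'.mem_invariants i) (hu'.homogeneous i)
    rw [← Subalgebra.mem_toSubmodule]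
    refine Submodule.span_le.2 ?_ h1
    rintro _ ⟨a, ha, rfl⟩
    refine Subalgebra.prod_mem _ fun j _ => ?_
    by_cases hj : a j = 0
    · rw [hj, pow_zero]
      exact one_mem _
    · refine Subalgebra.pow_mem _ ?_ _
      have h2 : d j ≤ n := by
        have h3 : d j * a j ≤ _ := Finset.single_le_sum (f := fun i => d i * a i) (fun _ _ => Nat.zero_le _)
          (Finset.mem_univ j)
        have h4 : d j ≤ d j * a j := Nat.le_mul_of_pos_right _ (Nat.pos_of_ne_zero hj)
        have := i.2
        omega
      exact ⟨X ⟨j, h2⟩, by simp [v]⟩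
  let u'' : {i // d' i ≤ n} → (aeval v : _ →ₐ[ℂ] MvPolynomial (Fin ℓ) ℂ).range :=
    fun i => ⟨u' i, hmem i⟩
  have hind : AlgebraicIndependent ℂ u'' := by
    refine AlgebraicIndependent.of_comp (Subalgebra.val _) ?_
    exact hu'.algebraicIndependent.comp _ Subtype.val_injective
  have h5 := hind.lift_cardinalMk_le_trdeg
  have h6 := lift_trdeg_le_of_surjective _
    (aeval v : _ →ₐ[ℂ] MvPolynomial (Fin ℓ) ℂ).rangeRestrict_surjective
  rw [trdeg_of_isDomain] at h6
  simpa using h5.trans h6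

theorem degree_eq (hu : IsHomogeneousGenerators e W d u)
    (hu' : IsHomogeneousGenerators e W d' u') : d = d' := by
  have hcard : ∀ n, Fintype.card {i // d i ≤ n} = Fintype.card {i // d' i ≤ n} :=
    fun n => le_antisymm (card_le hu' hu n) (card_le hu hu' n)
  have key : ∀ {d d' : Fin ℓ → ℕ}, Monotone d → Monotone d' →
      (∀ n, Fintype.card {i // d i ≤ n} = Fintype.card {i // d' i ≤ n}) → ∀ i, d i ≤ d' i := by
    intro d d' hd hd' h i
    by_contra! hlt
    have h1 : Fintype.card {j // d j ≤ d' i} ≤ Fintype.card {j // j < i} :=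
      Fintype.card_subtype_mono _ _ fun j (hj : d j ≤ d' i) => by
        by_contra! hij
        exact absurd (hd hij) (by omega)
    have h2 : Fintype.card {j // j ≤ i} ≤ Fintype.card {j // d' j ≤ d' i} :=
      Fintype.card_subtype_mono _ _ fun j (hj : j ≤ i) => hd' hj
    rw [h] at h1
    have h3 := h2.trans h1
    rw [Fintype.card_subtype, Fintype.card_subtype] at h3
    refine absurd h3 (not_le.2 (Finset.card_lt_card ?_))
    rw [Finset.ssubset_iff_of_subset (fun j => by simpa using le_of_lt)]
    exact ⟨i, by simp, by simp⟩
  funext i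
  exact le_antisymm (key hu.monotone hu'.monotone hcard i)
    (key hu'.monotone hu.monotone (fun n => (hcard n).symm) i)

end IsHomogeneousGenerators

end Generators
end Dunkl
end

/-! ### The order on exponents and triangularity of a change of generators. -/

noncomputable section

namespace Dunkl

open MvPolynomial

section Prec

variable {ℓ : ℕ}

theorem Prec.trans {a b c : Fin ℓ → ℕ} (hab : Prec a b) (hbc : Prec b c) : Prec a c := by
  obtain ⟨i, hi, hi'⟩ := hab
  obtain ⟨j, hj, hj'⟩ := hbc
  rcases lt_trichotomy i j with h | h | h
  · exact ⟨j, hi' j h ▸ hj, fun k hk => (hi' k (h.trans hk)).trans (hj' k hk)⟩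
  · subst h
    exact ⟨i, hi.trans hj, fun k hk => (hi' k hk).trans (hj' k hk)⟩
  · exact ⟨i, hj' i h ▸ hi, fun k hk => (hi' k hk).trans (hj' k (h.trans hk))⟩

theorem Prec.irrefl (a : Fin ℓ → ℕ) : ¬ Prec a a := fun ⟨_, hi, _⟩ => lt_irrefl _ hi

theorem Prec.add_right {a b : Fin ℓ → ℕ} (h : Prec a b) (c : Fin ℓ → ℕ) :
    Prec (a + c) (b + c) := by
  obtain ⟨i, hi, hi'⟩ := h
  exact ⟨i, by simpa using hi, fun k hk => by simp [hi' k hk]⟩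

theorem Prec.add_left {a b : Fin ℓ → ℕ} (h : Prec a b) (c : Fin ℓ → ℕ) :
    Prec (c + a) (c + b) := by
  rw [add_comm c, add_comm c]
  exact h.add_right c

/-- Distinctness of the degrees enters here: a generator after the `i`-th is too large in degree to
occur, and the `i`-th, if it occurs, exhausts the degree. -/
theorem eq_single_or_prec {d : Fin ℓ → ℕ} (hd : StrictMono d) (hpos : ∀ i, 0 < d i) {i : Fin ℓ}
    {a : Fin ℓ → ℕ} (ha : ∑ j, d j * a j = d i) :
    a = Pi.single i 1 ∨ Prec a (Pi.single i 1) := by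
  have hgt : ∀ j, i < j → a j = 0 := by
    intro j hj
    by_contra h
    have h1 : d j * a j ≤ _ := Finset.single_le_sum (f := fun j => d j * a j)
      (fun _ _ => Nat.zero_le _) (Finset.mem_univ j)
    have h2 : d j ≤ d j * a j := Nat.le_mul_of_pos_right _ (Nat.pos_of_ne_zero h)
    have h3 := hd hj
    omega
  rcases Nat.eq_zero_or_pos (a i) with h0 | h0
  · exact Or.inr ⟨i, by simp [h0], fun j hj => by simp [hgt j hj, hj.ne']⟩
  · left
    have hsum := Finset.add_sum_erase Finset.univ (fun j => d j * a j) (Finset.mem_univ i)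
    simp only [ha] at hsum
    have h1 : d i ≤ d i * a i := Nat.le_mul_of_pos_right _ h0
    have h2 : ∑ j ∈ Finset.univ.erase i, d j * a j = 0 := by omega
    have h3 : d i * a i = d i := by omega
    funext j
    by_cases hj : j = i
    · subst hj
      rw [Pi.single_eq_same]
      exact Nat.eq_of_mul_eq_mul_left (hpos j) (by rw [h3, mul_one])
    · have h4 := Finset.sum_eq_zero_iff.1 h2 j (by simp [hj])
      rw [Pi.single_eq_of_ne hj]
      exact (mul_eq_zero.1 h4).resolve_left (hpos j).ne'

end Prec

section LowerSpan

variable {ℓ : ℕ} {R A : Type*} [CommRing R] [CommRing A] [Algebra R A]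

/-- The span of the monomials in `u` that precede `u ^ a`. -/
def lowerSpan (R : Type*) {A : Type*} [CommRing R] [CommRing A] [Algebra R A] (u : Fin ℓ → A)
    (a : Fin ℓ → ℕ) : Submodule R A :=
  Submodule.span R {f | ∃ a', Prec a' a ∧ f = ∏ i, u i ^ a' i}

theorem lowerSpan_mono {u : Fin ℓ → A} {a b : Fin ℓ → ℕ} (h : Prec a b) :
    lowerSpan R u a ≤ lowerSpan R u b :=
  Submodule.span_mono fun _ ⟨a', h', hf⟩ => ⟨a', h'.trans h, hf⟩

theorem prod_pow_mem_lowerSpan {u : Fin ℓ → A} {a b : Fin ℓ → ℕ} (h : Prec a b) :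
    ∏ i, u i ^ a i ∈ lowerSpan R u b :=
  Submodule.subset_span ⟨a, h, rfl⟩

theorem prod_pow_notMem_lowerSpan {K : Type*} [Field K] [Algebra K A] {u : Fin ℓ → A}
    (hu : AlgebraicIndependent K u) (a : Fin ℓ → ℕ) : ∏ i, u i ^ a i ∉ lowerSpan K u a := by
  have h1 := hu.linearIndependent_prod_pow.notMem_span_image (s := {a' | Prec a' a}) (x := a)
    (Prec.irrefl a)
  have h2 : {f | ∃ a', Prec a' a ∧ f = ∏ i, u i ^ a' i} =
      (fun a : Fin ℓ → ℕ => ∏ i, u i ^ a i) '' {a' | Prec a' a} := by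
    ext f
    simp [eq_comm]
  rwa [lowerSpan, h2]

/-- `f` is a multiple of `u ^ a` plus a combination of monomials that precede it. -/
def HasLeading (R : Type*) {A : Type*} [CommRing R] [CommRing A] [Algebra R A] (u : Fin ℓ → A)
    (a : Fin ℓ → ℕ) (f : A) : Prop :=
  ∃ z : R, f - z • ∏ i, u i ^ a i ∈ lowerSpan R u a

theorem HasLeading.mul {u : Fin ℓ → A} {a b : Fin ℓ → ℕ} {f g : A} (hf : HasLeading R u a f)
    (hg : HasLeading R u b g) : HasLeading R u (a + b) (f * g) := by
  obtain ⟨z, hz⟩ := hf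
  obtain ⟨w, hw⟩ := hg
  have hprod : ∀ a b : Fin ℓ → ℕ,
      (∏ i, u i ^ a i) * ∏ i, u i ^ b i = ∏ i, u i ^ (a + b) i := fun a b => by
    simp [pow_add, Finset.prod_mul_distrib]
  have h1 : ∀ x ∈ lowerSpan R u a, x * ∏ i, u i ^ b i ∈ lowerSpan R u (a + b) := by
    intro x hx
    have : lowerSpan R u a ≤ (lowerSpan R u (a + b)).comap
        (LinearMap.mulRight R (∏ i, u i ^ b i)) := by
      refine Submodule.span_le.2 ?_
      rintro _ ⟨a', ha', rfl⟩
      rw [SetLike.mem_coe, Submodule.mem_comap, LinearMap.mulRight_apply, hprod]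
      exact prod_pow_mem_lowerSpan (ha'.add_right b)
    exact this hx
  have h2 : ∀ x ∈ lowerSpan R u b, (∏ i, u i ^ a i) * x ∈ lowerSpan R u (a + b) := by
    intro x hx
    have : lowerSpan R u b ≤ (lowerSpan R u (a + b)).comap
        (LinearMap.mulLeft R (∏ i, u i ^ a i)) := by
      refine Submodule.span_le.2 ?_
      rintro _ ⟨a', ha', rfl⟩
      rw [SetLike.mem_coe, Submodule.mem_comap, LinearMap.mulLeft_apply, hprod]
      exact prod_pow_mem_lowerSpan (ha'.add_left a)
    exact this hx
  have h3 : ∀ x ∈ lowerSpan R u a, ∀ y ∈ lowerSpan R u b, x * y ∈ lowerSpan R u (a + b) := by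
    intro x hx y hy
    have : lowerSpan R u a * lowerSpan R u b ≤ lowerSpan R u (a + b) := by
      rw [lowerSpan, lowerSpan, Submodule.span_mul_span, Submodule.span_le]
      rintro _ ⟨_, ⟨a', ha', rfl⟩, _, ⟨b', hb', rfl⟩, rfl⟩
      simp only [hprod]
      exact prod_pow_mem_lowerSpan ((ha'.add_right b').trans (hb'.add_left a))
    exact this (Submodule.mul_mem_mul hx hy)
  refine ⟨z * w, ?_⟩
  have h4 : f * g - (z * w) • ∏ i, u i ^ (a + b) i =
      (f - z • ∏ i, u i ^ a i) * (g - w • ∏ i, u i ^ b i) +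
      w • ((f - z • ∏ i, u i ^ a i) * ∏ i, u i ^ b i) +
      z • ((∏ i, u i ^ a i) * (g - w • ∏ i, u i ^ b i)) := by
    rw [← hprod]
    simp only [Algebra.smul_def, map_mul]
    ring
  rw [h4]
  exact add_mem (add_mem (h3 _ hz _ hw) (Submodule.smul_mem _ _ (h1 _ hz)))
    (Submodule.smul_mem _ _ (h2 _ hw))

theorem HasLeading.one (u : Fin ℓ → A) : HasLeading R u 0 1 := ⟨1, by simp⟩

theorem HasLeading.pow {u : Fin ℓ → A} {a : Fin ℓ → ℕ} {f : A} (hf : HasLeading R u a f) (n : ℕ) :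
    HasLeading R u (n • a) (f ^ n) := by
  induction n with
  | zero => simpa using HasLeading.one u
  | succ n ih =>
    rw [pow_succ, succ_nsmul]
    exact ih.mul hf

theorem HasLeading.prod {ι : Type*} {u : Fin ℓ → A} (s : Finset ι) {a : ι → Fin ℓ → ℕ} {f : ι → A}
    (hf : ∀ i, HasLeading R u (a i) (f i)) : HasLeading R u (∑ i ∈ s, a i) (∏ i ∈ s, f i) := by
  classical
  induction s using Finset.induction_on with
  | empty => simpa using HasLeading.one u
  | insert i s hi ih =>
    rw [Finset.sum_insert hi, Finset.prod_insert hi]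
    exact (hf i).mul ih

end LowerSpan

section

variable {V : Type*} [NormedAddCommGroup V] [InnerProductSpace ℝ V] {ℓ : ℕ}
    {e : OrthonormalBasis (Fin ℓ) ℝ V} {W : Subgroup (V ≃ₗᵢ[ℝ] V)}
    {d d' : Fin ℓ → ℕ} {u u' : Fin ℓ → MvPolynomial (Fin ℓ) ℂ}

namespace IsHomogeneousGenerators

theorem hasLeading (hu : IsHomogeneousGenerators e W d u)
    (hu' : IsHomogeneousGenerators e W d' u') (hd : Function.Injective d) (a : Fin ℓ → ℕ) :
    HasLeading ℂ u a (∏ i, u' i ^ a i) := by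
  obtain rfl := hu.degree_eq hu'
  have hs : StrictMono d := hu.monotone.strictMono_of_injective hd
  have h1 : ∀ i, HasLeading ℂ u (Pi.single i 1) (u' i) := by
    intro i
    have h2 := mem_span_prod_pow_of_isHomogeneous hu.homogeneous
      (hu.generate ▸ hu'.mem_invariants i) (hu'.homogeneous i)
    generalize u' i = y at h2 ⊢
    induction h2 using Submodule.span_induction with
    | mem x hx =>
      obtain ⟨b, hb, rfl⟩ := hx
      rcases eq_single_or_prec hs hu.degree_pos hb with rfl | h
      · exact ⟨1, by simp⟩
      · exact ⟨0, by simpa using prod_pow_mem_lowerSpan h⟩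
    | zero => exact ⟨0, by simp⟩
    | add x y _ _ hx hy =>
      obtain ⟨z, hz⟩ := hx
      obtain ⟨w, hw⟩ := hy
      refine ⟨z + w, ?_⟩
      rw [add_smul, add_sub_add_comm]
      exact add_mem hz hw
    | smul c x _ hx =>
      obtain ⟨z, hz⟩ := hx
      refine ⟨c * z, ?_⟩
      rw [mul_smul, ← smul_sub]
      exact Submodule.smul_mem _ _ hz
  have h3 := HasLeading.prod Finset.univ fun i => (h1 i).pow (a i)
  have h4 : ∑ i, a i • (Pi.single i 1 : Fin ℓ → ℕ) = a := by
    funext j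
    simp [Finset.sum_apply, Pi.single_apply]
  rwa [h4] at h3

theorem lowerSpan_le (hu : IsHomogeneousGenerators e W d u)
    (hu' : IsHomogeneousGenerators e W d' u') (hd : Function.Injective d) (a : Fin ℓ → ℕ) :
    lowerSpan ℂ u' a ≤ lowerSpan ℂ u a := by
  refine Submodule.span_le.2 ?_
  rintro _ ⟨a', ha', rfl⟩
  obtain ⟨z, hz⟩ := hu.hasLeading hu' hd a'
  rw [SetLike.mem_coe, ← sub_add_cancel (∏ i, u' i ^ a' i) (z • ∏ i, u i ^ a' i)]
  exact add_mem (lowerSpan_mono ha' hz) (Submodule.smul_mem _ _ (prod_pow_mem_lowerSpan ha'))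

/-- If the diagonal coefficient vanished, the lower span for `u`, contained in that for `u'`, would
contain `∏ u' i ^ a i`, against algebraic independence. -/
theorem exists_leading_ne_zero (hu : IsHomogeneousGenerators e W d u)
    (hu' : IsHomogeneousGenerators e W d' u') (hd : Function.Injective d) (a : Fin ℓ → ℕ) :
    ∃ z : ℂ, z ≠ 0 ∧ ∏ i, u' i ^ a i - z • ∏ i, u i ^ a i ∈ lowerSpan ℂ u a := by
  obtain ⟨z, hz⟩ := hu.hasLeading hu' hd a
  refine ⟨z, ?_, hz⟩
  rintro rfl
  rw [zero_smul, sub_zero] at hz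
  exact prod_pow_notMem_lowerSpan hu'.algebraicIndependent a
    (hu'.lowerSpan_le hu (hu.degree_eq hu' ▸ hd) a hz)

end IsHomogeneousGenerators

end

end Dunkl
end

/-! ### Bilinearity and grading of the form. -/

noncomputable section

namespace Dunkl

open MvPolynomial

variable {K : Type*} [Field K] [Algebra ℝ K] {V : Type*} [NormedAddCommGroup V]
    [InnerProductSpace ℝ V] {ℓ : ℕ} (e : OrthonormalBasis (Fin ℓ) ℝ V)
    {W : Subgroup (V ≃ₗᵢ[ℝ] V)} [Finite W] (c : Refl W → K)

theorem dunkl_basis (i : Fin ℓ) : dunkl e c (e i) = (pderiv i).toLinearMap -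
    ∑ s : Refl W, (c s * algebraMap ℝ K ⟪e i, root s⟫_ℝ) • divDiff K e s := by
  classical
  rw [dunkl]
  congr 2
  refine derivation_ext fun j => ?_
  rw [mkDerivation_X, pderiv_X, orthonormal_iff_ite.1 e.orthonormal]
  by_cases h : i = j
  · simp [h]
  · simp [h]

/-- The product of powers of Dunkl operators with exponents `m`. -/
def dunklMonomial (m : Fin ℓ →₀ ℕ) : Module.End K (MvPolynomial (Fin ℓ) K) :=
  ((List.finRange ℓ).map fun i => dunkl e c (e i) ^ m i).prod

theorem dunklPoly_eq_sum {p : MvPolynomial (Fin ℓ) K} {s : Finset (Fin ℓ →₀ ℕ)}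
    (hs : p.support ⊆ s) : dunklPoly e c p = ∑ m ∈ s, p.coeff m • dunklMonomial e c m :=
  Finset.sum_subset hs fun m _ hm => by rw [notMem_support_iff.1 hm, zero_smul]

theorem form_eq_sum {p : MvPolynomial (Fin ℓ) K} {s : Finset (Fin ℓ →₀ ℕ)}
    (hs : p.support ⊆ s) (g : MvPolynomial (Fin ℓ) K) :
    form e c p g = ∑ m ∈ s, p.coeff m * constantCoeff (dunklMonomial e c m g) := by
  simp [form, dunklPoly_eq_sum e c hs, LinearMap.sum_apply, constantCoeff_smul]

/-- The form as a bilinear map. -/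
def formBilin : MvPolynomial (Fin ℓ) K →ₗ[K] MvPolynomial (Fin ℓ) K →ₗ[K] K :=
  LinearMap.mk₂ K (form e c)
    (fun p q g => by
      classical
      rw [form_eq_sum e c support_add, form_eq_sum e c Finset.subset_union_left,
        form_eq_sum e c (p := q) Finset.subset_union_right, ← Finset.sum_add_distrib]
      simp_rw [coeff_add, add_mul])
    (fun r p g => by
      rw [form_eq_sum e c support_smul, form_eq_sum e c subset_rfl, Finset.smul_sum]
      simp_rw [coeff_smul, smul_eq_mul, mul_assoc])
    (fun p g h => by simp [form])
    (fun r p g => by simp [form, constantCoeff_smul])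

@[simp] theorem formBilin_apply (f g : MvPolynomial (Fin ℓ) K) :
    formBilin e c f g = form e c f g := rfl

/-- All monomials of `f` have degree `k`, where `k` may be negative. -/
def IsHomogeneousOfIntDegree (k : ℤ) (f : MvPolynomial (Fin ℓ) K) : Prop :=
  ∀ m, coeff m f ≠ 0 → (m.degree : ℤ) = k

-- Integer degrees let the shift by `-1` apply without exception: a polynomial of negative degree is
-- zero, whereas truncated subtraction would keep constants in degree zero.
variable {e c} in
theorem IsHomogeneousOfIntDegree.dunkl {k : ℤ} {f : MvPolynomial (Fin ℓ) K}
    (hf : IsHomogeneousOfIntDegree k f) (i : Fin ℓ) :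
    IsHomogeneousOfIntDegree (k - 1) (dunkl e c (e i) f) := by
  intro m hm
  rw [dunkl_basis, LinearMap.sub_apply, coeff_sub] at hm
  by_cases h : coeff m (pderiv i f) = 0
  · rw [Derivation.coeFn_coe, h, zero_sub, neg_ne_zero, LinearMap.sum_apply, coeff_sum] at hm
    obtain ⟨s, -, hs⟩ := Finset.exists_ne_zero_of_sum_ne_zero hm
    rw [LinearMap.smul_apply, coeff_smul] at hs
    have h1 : homogeneousComponent m.degree (divDiff K e s f) ≠ 0 := by
      intro h0
      have h2 := congrArg (coeff m) h0
      rw [coeff_homogeneousComponent, if_pos rfl, coeff_zero] at h2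
      exact hs (by rw [h2, smul_zero])
    rw [homogeneousComponent_divDiff] at h1
    have h2 : homogeneousComponent (m.degree + 1) f ≠ 0 := fun h0 => h1 (by rw [h0, map_zero])
    obtain ⟨m', hm'⟩ := ne_zero_iff.1 h2
    rw [coeff_homogeneousComponent] at hm'
    split_ifs at hm' with h3
    · have := hf m' hm'
      omega
    · exact absurd rfl hm'
  · rw [coeff_pderiv] at h
    have := hf _ (left_ne_zero_of_mul h)
    rw [map_add, Finsupp.degree_single] at this
    omega

variable {e c} in
theorem IsHomogeneousOfIntDegree.dunklMonomial {k : ℤ} {f : MvPolynomial (Fin ℓ) K}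
    (hf : IsHomogeneousOfIntDegree k f) (m : Fin ℓ →₀ ℕ) :
    IsHomogeneousOfIntDegree (k - m.degree) (dunklMonomial e c m f) := by
  have hpow : ∀ (i : Fin ℓ) (n : ℕ) {k : ℤ} {f : MvPolynomial (Fin ℓ) K},
      IsHomogeneousOfIntDegree k f →
      IsHomogeneousOfIntDegree (k - n) ((Dunkl.dunkl e c (e i) ^ n) f) := by
    intro i n
    induction n with
    | zero => intro k f hf; simpa using hf
    | succ n ih =>
      intro k f hf
      rw [pow_succ', Module.End.mul_apply, Nat.cast_succ, ← sub_sub]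
      exact (ih hf).dunkl i
  have hlist : ∀ L : List (Fin ℓ), IsHomogeneousOfIntDegree (k - (L.map m).sum)
      ((L.map fun i => Dunkl.dunkl e c (e i) ^ m i).prod f) := by
    intro L
    induction L with
    | nil => simpa using hf
    | cons i L ih =>
      rw [List.map_cons, List.map_cons, List.prod_cons, List.sum_cons, Module.End.mul_apply,
        Nat.cast_add, add_comm, ← sub_sub]
      exact hpow i _ ih
  have h := hlist (List.finRange ℓ)
  rwa [← Fin.sum_univ_def, ← Finsupp.degree_eq_sum] at h

theorem form_eq_zero_of_isHomogeneous {f g : MvPolynomial (Fin ℓ) K} {n k : ℕ}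
    (hf : f.IsHomogeneous n) (hg : g.IsHomogeneous k) (hnk : n ≠ k) : form e c f g = 0 := by
  rw [form_eq_sum e c subset_rfl]
  refine Finset.sum_eq_zero fun m hm => ?_
  have h1 : m.degree = n := by
    by_contra h
    exact mem_support_iff.1 hm (hf.coeff_eq_zero h)
  have h2 : IsHomogeneousOfIntDegree (k : ℤ) g := fun m hm => by
    by_contra h
    exact hm (hg.coeff_eq_zero (by exact_mod_cast h))
  have h3 := h2.dunklMonomial (e := e) (c := c) m 0
  rw [← constantCoeff_eq] at h3
  by_contra h
  have h4 := h3 (right_ne_zero_of_mul h)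
  simp only [map_zero] at h4
  omega

end Dunkl
end

/-! ### Specialization at `c = 0` and Gram determinants. -/

noncomputable section

namespace Dunkl

open MvPolynomial

section Specialization

variable {V : Type*} [NormedAddCommGroup V] [InnerProductSpace ℝ V] {ℓ : ℕ}
    {W : Subgroup (V ≃ₗᵢ[ℝ] V)}

/-- `f` has coefficients without pole at `c = 0`, and their values are those of `f₀`. -/
def SpecializesTo (f : MvPolynomial (Fin ℓ) (ParamField W)) (f₀ : MvPolynomial (Fin ℓ) ℂ) : Prop :=
  ∃ F : MvPolynomial (Fin ℓ) (MvPolynomial (ReflClass W) ℂ),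
    map (algebraMap _ (ParamField W)) F = f ∧ map constantCoeff F = f₀

namespace SpecializesTo

variable {f g : MvPolynomial (Fin ℓ) (ParamField W)} {f₀ g₀ : MvPolynomial (Fin ℓ) ℂ}

theorem of_map (g : MvPolynomial (Fin ℓ) ℂ) :
    SpecializesTo (map (algebraMap ℂ (ParamField W)) g) g :=
  ⟨map C g, by
    rw [map_map, IsScalarTower.algebraMap_eq ℂ (MvPolynomial (ReflClass W) ℂ) (ParamField W)]
    rfl, by
    rw [map_map, constantCoeff_comp_C, map_id]⟩

theorem zero : SpecializesTo (0 : MvPolynomial (Fin ℓ) (ParamField W)) 0 := ⟨0, by simp, by simp⟩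

theorem add (hf : SpecializesTo f f₀) (hg : SpecializesTo g g₀) :
    SpecializesTo (f + g) (f₀ + g₀) := by
  obtain ⟨F, rfl, rfl⟩ := hf
  obtain ⟨G, rfl, rfl⟩ := hg
  exact ⟨F + G, map_add _ _ _, map_add _ _ _⟩

theorem sub (hf : SpecializesTo f f₀) (hg : SpecializesTo g g₀) :
    SpecializesTo (f - g) (f₀ - g₀) := by
  obtain ⟨F, rfl, rfl⟩ := hf
  obtain ⟨G, rfl, rfl⟩ := hg
  exact ⟨F - G, map_sub _ _ _, map_sub _ _ _⟩

theorem smul (hf : SpecializesTo f f₀) (r : MvPolynomial (ReflClass W) ℂ) :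
    SpecializesTo (algebraMap _ (ParamField W) r • f) (constantCoeff r • f₀) := by
  obtain ⟨F, rfl, rfl⟩ := hf
  exact ⟨C r * F, by rw [map_mul, map_C, smul_eq_C_mul], by rw [map_mul, map_C, smul_eq_C_mul]⟩

theorem sum {ι : Type*} (s : Finset ι) {f : ι → MvPolynomial (Fin ℓ) (ParamField W)}
    {f₀ : ι → MvPolynomial (Fin ℓ) ℂ} (h : ∀ i ∈ s, SpecializesTo (f i) (f₀ i)) :
    SpecializesTo (∑ i ∈ s, f i) (∑ i ∈ s, f₀ i) := by
  classical
  induction s using Finset.induction_on with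
  | empty => exact zero
  | insert i s hi ih =>
    rw [Finset.sum_insert hi, Finset.sum_insert hi]
    exact (h i (by simp)).add (ih fun j hj => h j (by simp [hj]))

theorem constantCoeff (hf : SpecializesTo f f₀) : ∃ r : MvPolynomial (ReflClass W) ℂ,
    MvPolynomial.constantCoeff f = algebraMap _ (ParamField W) r ∧
      MvPolynomial.constantCoeff r = MvPolynomial.constantCoeff f₀ := by
  obtain ⟨F, rfl, rfl⟩ := hf
  exact ⟨MvPolynomial.constantCoeff F, constantCoeff_map _ _, (constantCoeff_map _ _).symm⟩

theorem apply_linearMap {T : Module.End (ParamField W) (MvPolynomial (Fin ℓ) (ParamField W))}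
    {T₀ : Module.End ℂ (MvPolynomial (Fin ℓ) ℂ)}
    (hT : ∀ m, SpecializesTo (T (monomial m 1)) (T₀ (monomial m 1)))
    (hf : SpecializesTo f f₀) : SpecializesTo (T f) (T₀ f₀) := by
  obtain ⟨F, rfl, rfl⟩ := hf
  induction F using MvPolynomial.induction_on' with
  | monomial m r =>
    rw [map_monomial, map_monomial, ← mul_one (algebraMap _ _ r),
      ← mul_one (MvPolynomial.constantCoeff r), ← smul_eq_mul, ← smul_eq_mul, ← smul_monomial,
      ← smul_monomial, map_smul, map_smul]
    exact (hT m).smul r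
  | add F G hF hG =>
    rw [map_add, map_add, map_add, map_add]
    exact hF.add hG

end SpecializesTo

variable (e : OrthonormalBasis (Fin ℓ) ℝ V) [Finite W]

theorem SpecializesTo.dunkl {f : MvPolynomial (Fin ℓ) (ParamField W)}
    {f₀ : MvPolynomial (Fin ℓ) ℂ} (hf : SpecializesTo f f₀) (i : Fin ℓ) :
    SpecializesTo (dunkl e (param W) (e i) f) (pderiv i f₀) := by
  refine hf.apply_linearMap (T₀ := (pderiv i).toLinearMap) fun m => ?_
  have hm : (monomial m 1 : MvPolynomial (Fin ℓ) (ParamField W)) =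
      map (algebraMap ℂ (ParamField W)) (monomial m 1) := by simp
  have hr : ∀ s : Refl W, ∃ r : MvPolynomial (ReflClass W) ℂ,
      param W s * algebraMap ℝ (ParamField W) ⟪e i, root s⟫_ℝ = algebraMap _ (ParamField W) r ∧
        MvPolynomial.constantCoeff r = 0 := by
    intro s
    obtain ⟨x, hx⟩ : ∃ x : ReflClass W, param W s = algebraMap _ (ParamField W) (X x) := ⟨_, rfl⟩
    refine ⟨X x * C (algebraMap ℝ ℂ ⟪e i, root s⟫_ℝ), ?_, by simp⟩
    rw [map_mul, hx, ← algebraMap_eq, ← IsScalarTower.algebraMap_apply,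
      ← IsScalarTower.algebraMap_apply]
  choose r hr hr' using hr
  -- The coefficients `r s` vanish at `c = 0`, so subtracting these zero multiples gives the
  -- derivative the shape of a Dunkl operator, and the two sides match term by term.
  have h2 : ((pderiv i).toLinearMap (monomial m 1) : MvPolynomial (Fin ℓ) ℂ) =
      pderiv i (monomial m 1) - ∑ s : Refl W,
        MvPolynomial.constantCoeff (r s) • divDiff ℂ e s (monomial m 1) := by
    rw [Derivation.coeFn_coe, Finset.sum_eq_zero fun s _ => by rw [hr', zero_smul], sub_zero]
  rw [h2, hm, dunkl_basis, LinearMap.sub_apply, LinearMap.sum_apply, Derivation.coeFn_coe,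
    pderiv_map]
  refine (SpecializesTo.of_map _).sub (SpecializesTo.sum _ fun s _ => ?_)
  rw [LinearMap.smul_apply, ← map_divDiff, hr]
  exact (SpecializesTo.of_map _).smul _

theorem SpecializesTo.dunklMonomial {f : MvPolynomial (Fin ℓ) (ParamField W)}
    {f₀ : MvPolynomial (Fin ℓ) ℂ} (hf : SpecializesTo f f₀) (m : Fin ℓ →₀ ℕ) :
    SpecializesTo (dunklMonomial e (param W) m f)
      (((List.finRange ℓ).map fun i => (pderiv (R := ℂ) i).toLinearMap ^ m i).prod f₀) := by
  have hpow : ∀ (i : Fin ℓ) (n : ℕ) {f : MvPolynomial (Fin ℓ) (ParamField W)}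
      {f₀ : MvPolynomial (Fin ℓ) ℂ}, SpecializesTo f f₀ →
      SpecializesTo ((Dunkl.dunkl e (param W) (e i) ^ n) f)
        (((pderiv (R := ℂ) i).toLinearMap ^ n) f₀) := by
    intro i n
    induction n with
    | zero => intro f f₀ hf; simpa using hf
    | succ n ih =>
      intro f f₀ hf
      rw [pow_succ', pow_succ', Module.End.mul_apply, Module.End.mul_apply]
      exact (ih hf).dunkl e i
  rw [Dunkl.dunklMonomial]
  generalize List.finRange ℓ = L
  induction L with
  | nil => simpa using hf
  | cons i L ih =>
    rw [List.map_cons, List.map_cons, List.prod_cons, List.prod_cons, Module.End.mul_apply,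
      Module.End.mul_apply]
    exact hpow i _ ih

/-- Iterated differentiation produces the factor `∏ (m i)!`; only its positivity matters. -/
theorem exists_coeff_pderiv_pow {ℓ : ℕ} (m : Fin ℓ →₀ ℕ) : ∃ N : ℕ, 0 < N ∧
    ∀ h : MvPolynomial (Fin ℓ) ℂ, MvPolynomial.constantCoeff
      (((List.finRange ℓ).map fun i => (pderiv (R := ℂ) i).toLinearMap ^ m i).prod h) =
        coeff m h * N := by
  have hpow : ∀ (i : Fin ℓ) (k : ℕ) (n : Fin ℓ →₀ ℕ), ∃ N : ℕ, 0 < N ∧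
      ∀ h : MvPolynomial (Fin ℓ) ℂ, coeff n (((pderiv (R := ℂ) i).toLinearMap ^ k) h) =
        coeff (n + Finsupp.single i k) h * N := by
    intro i k
    induction k with
    | zero => exact fun n => ⟨1, one_pos, fun h => by simp⟩
    | succ k ih =>
      intro n
      obtain ⟨N, hN, h1⟩ := ih (n + Finsupp.single i 1)
      refine ⟨N * (n i + 1), by positivity, fun h => ?_⟩
      rw [pow_succ', Module.End.mul_apply, Derivation.coeFn_coe, coeff_pderiv, h1, add_assoc,
        ← Finsupp.single_add, add_comm 1 k]
      push_cast
      ring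
  have hlist : ∀ (L : List (Fin ℓ)) (n : Fin ℓ →₀ ℕ), ∃ N : ℕ, 0 < N ∧
      ∀ h : MvPolynomial (Fin ℓ) ℂ, coeff n
        ((L.map fun i => (pderiv (R := ℂ) i).toLinearMap ^ m i).prod h) =
        coeff (n + (L.map fun i => Finsupp.single i (m i)).sum) h * N := by
    intro L
    induction L with
    | nil => exact fun n => ⟨1, one_pos, fun h => by simp⟩
    | cons i L ih =>
      intro n
      obtain ⟨N, hN, h1⟩ := hpow i (m i) n
      obtain ⟨M, hM, h2⟩ := ih (n + Finsupp.single i (m i))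
      refine ⟨M * N, by positivity, fun h => ?_⟩
      rw [List.map_cons, List.map_cons, List.prod_cons, List.sum_cons, Module.End.mul_apply, h1,
        h2, add_assoc]
      push_cast
      ring
  obtain ⟨N, hN, h1⟩ := hlist (List.finRange ℓ) 0
  refine ⟨N, hN, fun h => ?_⟩
  rw [constantCoeff_eq, h1, zero_add, ← Fin.sum_univ_def, Finsupp.univ_sum_single]

/-- The weights are fixed before `f` and `g`, so that all entries of a Gram matrix share them. -/
theorem exists_weights (ℓ : ℕ) : ∃ N : (Fin ℓ →₀ ℕ) → ℕ, (∀ m, 0 < N m) ∧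
    ∀ {V : Type*} [NormedAddCommGroup V] [InnerProductSpace ℝ V] (e : OrthonormalBasis (Fin ℓ) ℝ V)
      {W : Subgroup (V ≃ₗᵢ[ℝ] V)} [Finite W] (f g : MvPolynomial (Fin ℓ) ℂ),
      ∃ r : MvPolynomial (ReflClass W) ℂ,
        form e (param W) (map (algebraMap ℂ (ParamField W)) f)
          (map (algebraMap ℂ (ParamField W)) g) = algebraMap _ (ParamField W) r ∧
        MvPolynomial.constantCoeff r = ∑ m ∈ f.support, coeff m f * (coeff m g * N m) := by
  choose N hN h using exists_coeff_pderiv_pow (ℓ := ℓ)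
  refine ⟨N, hN, fun e W _ f g => ?_⟩
  choose r hr hr' using fun m =>
    ((SpecializesTo.of_map (W := W) g).dunklMonomial e m).constantCoeff
  refine ⟨∑ m ∈ f.support, C (coeff m f) * r m, ?_, ?_⟩
  · rw [form_eq_sum e (param W) (support_map_subset _ _), map_sum]
    refine Finset.sum_congr rfl fun m _ => ?_
    rw [hr, coeff_map, map_mul, ← algebraMap_eq, ← IsScalarTower.algebraMap_apply]
  · simp [hr', h]

/-- The entries are polynomials in `c`, and at `c = 0` they form the real matrix `A` with `xᵀAx = ∑
N m * (∑ x i * coeff m (v i))²`. A kernel vector of `A` would be a linear relation between the `v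
i`; hence the determinant is nonzero at `c = 0`. -/
theorem gram_det_ne_zero {ι : Type*} [Fintype ι] [DecidableEq ι]
    {v : ι → MvPolynomial (Fin ℓ) ℝ} (hv : LinearIndependent ℝ v) :
    (Matrix.of fun i j => form e (param W)
      (map (algebraMap ℂ (ParamField W)) (map (algebraMap ℝ ℂ) (v i)))
      (map (algebraMap ℂ (ParamField W)) (map (algebraMap ℝ ℂ) (v j)))).det ≠ 0 := by
  obtain ⟨N, hN, hform⟩ := exists_weights ℓ
  choose r hr hr' using fun i j =>
    hform e (W := W) (map (algebraMap ℝ ℂ) (v i)) (map (algebraMap ℝ ℂ) (v j))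
  let M : Finset (Fin ℓ →₀ ℕ) := Finset.univ.biUnion fun i => (v i).support
  let A : Matrix ι ι ℝ := Matrix.of fun i j => ∑ m ∈ M, coeff m (v i) * (coeff m (v j) * N m)
  have hA : A.det ≠ 0 := by
    intro h0
    obtain ⟨x, hx, hAx⟩ := Matrix.exists_mulVec_eq_zero_iff.2 h0
    refine hx ?_
    have h1 : ∑ m ∈ M, (N m : ℝ) * (∑ i, x i * coeff m (v i)) ^ 2 = 0 := by
      have h2 : x ⬝ᵥ A.mulVec x = 0 := by rw [hAx, dotProduct_zero]
      rw [← h2]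
      simp only [dotProduct, Matrix.mulVec, A, Matrix.of_apply, Finset.mul_sum, Finset.sum_mul]
      simp_rw [pow_two, Finset.sum_mul_sum, Finset.mul_sum]
      rw [Finset.sum_comm]
      refine Finset.sum_congr rfl fun i _ => ?_
      rw [Finset.sum_comm]
      exact Finset.sum_congr rfl fun j _ => Finset.sum_congr rfl fun m _ => by ring
    rw [Finset.sum_eq_zero_iff_of_nonneg fun m _ => by positivity] at h1
    have h3 : ∑ i, x i • v i = 0 := by
      ext m
      rw [coeff_sum, coeff_zero]
      simp only [coeff_smul, smul_eq_mul]
      by_cases hm : m ∈ M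
      · have h4 := (mul_eq_zero.1 (h1 m hm)).resolve_left (by exact_mod_cast (hN m).ne')
        exact pow_eq_zero_iff (two_ne_zero) |>.1 h4
      · refine Finset.sum_eq_zero fun i _ => ?_
        have : m ∉ (v i).support := fun h => hm (Finset.mem_biUnion.2 ⟨i, by simp, h⟩)
        rw [notMem_support_iff.1 this, mul_zero]
    exact funext (Fintype.linearIndependent_iff.1 hv x h3)
  have h1 : (Matrix.of r).map (MvPolynomial.constantCoeff (σ := ReflClass W) (R := ℂ)) =
      A.map (algebraMap ℝ ℂ) := by
    ext i j
    simp only [Matrix.map_apply, Matrix.of_apply, hr', A, map_sum]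
    rw [Finset.sum_subset (s₂ := M)]
    · refine Finset.sum_congr rfl fun m _ => ?_
      rw [coeff_map, coeff_map, map_mul, map_mul, map_natCast]
    · exact (support_map_subset _ _).trans (Finset.subset_biUnion_of_mem
        (fun i => (v i).support) (Finset.mem_univ i))
    · intro m _ hm
      rw [notMem_support_iff.1 hm, zero_mul]
  have h2 : (Matrix.of r).det ≠ 0 := by
    intro h0
    have h3 := congrArg (MvPolynomial.constantCoeff (σ := ReflClass W) (R := ℂ)) h0
    rw [map_zero, RingHom.map_det, RingHom.mapMatrix_apply, h1, ← RingHom.mapMatrix_apply,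
      ← RingHom.map_det] at h3
    exact hA ((map_eq_zero (algebraMap ℝ ℂ)).1 h3)
  have h3 : (Matrix.of fun i j => form e (param W)
      (map (algebraMap ℂ (ParamField W)) (map (algebraMap ℝ ℂ) (v i)))
      (map (algebraMap ℂ (ParamField W)) (map (algebraMap ℝ ℂ) (v j)))) =
      (algebraMap _ (ParamField W)).mapMatrix (Matrix.of r) := by
    ext i j
    simp [hr]
  rw [h3, ← RingHom.map_det]
  exact fun h0 => h2 ((IsFractionRing.injective _ (ParamField W)) (h0.trans (map_zero _).symm))

end Specialization

end Dunkl
end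

/-! ### Existence, uniqueness and independence of the generators. -/

noncomputable section

namespace Dunkl

open MvPolynomial

variable {V : Type*} [NormedAddCommGroup V] [InnerProductSpace ℝ V] {ℓ : ℕ}
    {e : OrthonormalBasis (Fin ℓ) ℝ V} {W : Subgroup (V ≃ₗᵢ[ℝ] V)}
    {d d' : Fin ℓ → ℕ} {u u' : Fin ℓ → MvPolynomial (Fin ℓ) ℂ}

theorem map_mem_span_mono {a : Fin ℓ → ℕ} {f : MvPolynomial (Fin ℓ) ℂ}
    (hf : f ∈ lowerSpan ℂ u a) : map (algebraMap ℂ (ParamField W)) f ∈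
      Submodule.span (ParamField W) {f | ∃ a', Prec a' a ∧ f = mono W u a'} := by
  induction hf using Submodule.span_induction with
  | mem f hf =>
    obtain ⟨a', ha', rfl⟩ := hf
    exact Submodule.subset_span ⟨a', ha', rfl⟩
  | zero => simp
  | add f g _ _ hf hg =>
    rw [map_add]
    exact add_mem hf hg
  | smul z f _ hf =>
    rw [smul_eq_C_mul, map_mul, map_C, ← smul_eq_C_mul]
    exact Submodule.smul_mem _ _ hf

theorem map_smul_complex (z : ℂ) (f : MvPolynomial (Fin ℓ) ℂ) :
    map (algebraMap ℂ (ParamField W)) (z • f) = z • map (algebraMap ℂ (ParamField W)) f := by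
  rw [smul_eq_C_mul, map_mul, map_C, ← smul_eq_C_mul, algebraMap_smul]

namespace IsHomogeneousGenerators

theorem mono_mem_invariants (hu : IsHomogeneousGenerators e W d u) (a : Fin ℓ → ℕ) :
    mono W u a ∈ invariants (ParamField W) e W :=
  map_mem_invariants _ (prod_mem fun i _ => pow_mem (hu.mem_invariants i) _)

theorem mono_isHomogeneous (hu : IsHomogeneousGenerators e W d u) (a : Fin ℓ → ℕ) :
    (mono W u a).IsHomogeneous (∑ i, d i * a i) :=
  (isHomogeneous_prod_pow hu.homogeneous a).map _

theorem span_mono_le (hu : IsHomogeneousGenerators e W d u)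
    (hu' : IsHomogeneousGenerators e W d' u') (hd : Function.Injective d) (a : Fin ℓ → ℕ) :
    Submodule.span (ParamField W) {f | ∃ a', Prec a' a ∧ f = mono W u' a'} ≤
      Submodule.span (ParamField W) {f | ∃ a', Prec a' a ∧ f = mono W u a'} := by
  refine Submodule.span_le.2 ?_
  rintro _ ⟨a', ha', rfl⟩
  exact map_mem_span_mono (hu.lowerSpan_le hu' hd a (prod_pow_mem_lowerSpan ha'))

end IsHomogeneousGenerators

variable [Finite W]

theorem IsCanonical.form_eq_zero {a : Fin ℓ → ℕ} {b : MvPolynomial (Fin ℓ) (ParamField W)}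
    (hb : IsCanonical e W u a b) {f : MvPolynomial (Fin ℓ) (ParamField W)}
    (hf : f ∈ Submodule.span (ParamField W) {f | ∃ a', Prec a' a ∧ f = mono W u a'}) :
    form e (param W) f b = 0 := by
  have h : Submodule.span (ParamField W) {f | ∃ a', Prec a' a ∧ f = mono W u a'} ≤
      LinearMap.ker ((formBilin e (param W)).flip b) := by
    refine Submodule.span_le.2 ?_
    rintro _ ⟨a', ha', rfl⟩
    exact hb.orthogonal a' ha'
  exact h hf

theorem IsCanonical.of_generators {a : Fin ℓ → ℕ} {b : MvPolynomial (Fin ℓ) (ParamField W)}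
    (hb : IsCanonical e W u a b) (hu : IsHomogeneousGenerators e W d u)
    (hu' : IsHomogeneousGenerators e W d' u') (hd : Function.Injective d) :
    IsCanonical e W u' a b := by
  have hd' : Function.Injective d' := hu.degree_eq hu' ▸ hd
  refine ⟨?_, fun a' ha' =>
    hb.form_eq_zero (hu.span_mono_le hu' hd a (Submodule.subset_span ⟨a', ha', rfl⟩))⟩
  obtain ⟨z, hz, h1⟩ := hb.leading
  obtain ⟨y, hy, h2⟩ := hu'.exists_leading_ne_zero hu hd' a
  refine ⟨z * y, mul_ne_zero hz hy, ?_⟩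
  have h3 := map_mem_span_mono (W := W) h2
  rw [map_sub, map_smul_complex] at h3
  have h4 := add_mem (hu'.span_mono_le hu hd' a h1) (Submodule.smul_of_tower_mem _ z h3)
  rw [smul_sub, ← mul_smul] at h4
  simpa only [mono, sub_add_sub_cancel] using h4

section Real

variable {u : Fin ℓ → MvPolynomial (Fin ℓ) ℝ}

theorem gram_mono_det_ne_zero (hu : AlgebraicIndependent ℝ u) {ι : Type*} [Fintype ι]
    [DecidableEq ι] {s : ι → Fin ℓ → ℕ} (hs : Function.Injective s) :
    (Matrix.of fun i j => form e (param W) (mono W (fun k => map (algebraMap ℝ ℂ) (u k)) (s i))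
      (mono W (fun k => map (algebraMap ℝ ℂ) (u k)) (s j))).det ≠ 0 := by
  have h := gram_det_ne_zero e (W := W) (hu.linearIndependent_prod_pow.comp s hs)
  simpa only [mono, Function.comp_apply, map_prod, map_pow] using h

theorem exists_isCanonical (hi : AlgebraicIndependent ℝ u)
    (hu : IsHomogeneousGenerators e W d fun k => map (algebraMap ℝ ℂ) (u k)) (a : Fin ℓ → ℕ) :
    ∃ b, b ∈ invariants (ParamField W) e W ∧ b.IsHomogeneous (∑ i, d i * a i) ∧
      IsCanonical e W (fun k => map (algebraMap ℝ ℂ) (u k)) a b := by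
  classical
  -- Infinitely many exponents may precede `a`; fixing the degree leaves finitely many, because all
  -- `d i` are positive.
  let F : Set (Fin ℓ → ℕ) := {a' | Prec a' a ∧ ∑ i, d i * a' i = ∑ i, d i * a i}
  have hF : F.Finite := by
    refine (Set.finite_Iic fun _ : Fin ℓ => ∑ i, d i * a i).subset fun a' ha' i => ?_
    refine (Nat.le_mul_of_pos_left _ (hu.degree_pos i)).trans ?_
    rw [← ha'.2]
    exact Finset.single_le_sum (f := fun i => d i * a' i) (fun _ _ => Nat.zero_le _)
      (Finset.mem_univ i)
  have := hF.fintype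
  let v : (Fin ℓ → ℕ) → MvPolynomial (Fin ℓ) (ParamField W) :=
    mono W fun k => map (algebraMap ℝ ℂ) (u k)
  let G : Matrix F F (ParamField W) := Matrix.of fun i j => form e (param W) (v i) (v j)
  have hG : G.det ≠ 0 := gram_mono_det_ne_zero hi Subtype.val_injective
  let y : F → ParamField W := fun i => -form e (param W) (v i) (v a)
  -- `G x = y` says that `v a + ∑ x j • v j` is orthogonal to every `v i` with `i` in `F`.
  let x : F → ParamField W := G⁻¹.mulVec y
  have hx : G.mulVec x = y := by
    rw [Matrix.mulVec_mulVec, Matrix.mul_nonsing_inv _ (isUnit_iff_ne_zero.2 hG), Matrix.one_mulVec]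
  have hhom : (v a + ∑ j : F, x j • v j).IsHomogeneous (∑ i, d i * a i) := by
    refine (hu.mono_isHomogeneous a).add (IsHomogeneous.sum _ _ _ fun j _ => ?_)
    rw [smul_eq_C_mul, ← j.2.2]
    exact (hu.mono_isHomogeneous j).C_mul _
  refine ⟨v a + ∑ j : F, x j • v j, ?_, hhom, ⟨1, one_ne_zero, ?_⟩, ?_⟩
  · exact add_mem (hu.mono_mem_invariants a)
      (sum_mem fun j _ => Subalgebra.smul_mem _ (hu.mono_mem_invariants j) _)
  · rw [one_smul, add_sub_cancel_left]
    exact sum_mem fun j _ => Submodule.smul_mem _ _ (Submodule.subset_span ⟨j, j.2.1, rfl⟩)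
  · intro a' ha'
    by_cases h : ∑ i, d i * a' i = ∑ i, d i * a i
    · have h1 := congrFun hx ⟨a', ha', h⟩
      simp only [Matrix.mulVec, dotProduct, G, Matrix.of_apply, y] at h1
      rw [← formBilin_apply, map_add, map_sum]
      simp_rw [map_smul, formBilin_apply, smul_eq_mul, mul_comm (x _)]
      rw [h1]
      exact add_neg_cancel _
    · exact form_eq_zero_of_isHomogeneous e _ (hu.mono_isHomogeneous a') hhom h

/-- Only the finitely many monomials occurring in `f` are needed: their Gram matrix kills the
coefficient vector and is invertible. No homogeneity of `f` is involved. -/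
theorem eq_zero_of_orthogonal (hi : AlgebraicIndependent ℝ u) (e : OrthonormalBasis (Fin ℓ) ℝ V)
    {a : Fin ℓ → ℕ} {f : MvPolynomial (Fin ℓ) (ParamField W)}
    (hf : f ∈ Submodule.span (ParamField W)
      {f | ∃ a', Prec a' a ∧ f = mono W (fun k => map (algebraMap ℝ ℂ) (u k)) a'})
    (horth : ∀ a', Prec a' a →
      form e (param W) (mono W (fun k => map (algebraMap ℝ ℂ) (u k)) a') f = 0) : f = 0 := by
  classical
  let v : (Fin ℓ → ℕ) → MvPolynomial (Fin ℓ) (ParamField W) :=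
    mono W fun k => map (algebraMap ℝ ℂ) (u k)
  have h1 : {f | ∃ a', Prec a' a ∧ f = v a'} = v '' {a' | Prec a' a} := by
    ext f
    simp [eq_comm]
  change f ∈ Submodule.span _ {f | ∃ a', Prec a' a ∧ f = v a'} at hf
  rw [h1, Finsupp.mem_span_image_iff_linearCombination] at hf
  obtain ⟨l, hl, rfl⟩ := hf
  rw [Finsupp.mem_supported] at hl
  rw [Finsupp.linearCombination_apply, Finsupp.sum, ← Finset.sum_coe_sort] at horth ⊢
  have h2 : (fun t : l.support => l t) = 0 := by
    refine Matrix.eq_zero_of_mulVec_eq_zero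
      (gram_mono_det_ne_zero (e := e) (W := W) hi (s := fun t : l.support => (t : Fin ℓ → ℕ))
        Subtype.val_injective) ?_
    funext t
    have h3 := horth t (hl t.2)
    rw [← formBilin_apply, map_sum] at h3
    simp_rw [map_smul, formBilin_apply, smul_eq_mul, mul_comm (l _)] at h3
    exact h3
  exact Finset.sum_eq_zero fun t _ => by rw [congrFun h2 t, Pi.zero_apply, zero_smul]

end Real

end Dunkl
end

theorem theorem1 {V : Type*} [NormedAddCommGroup V] [InnerProductSpace ℝ V] {ℓ : ℕ}
    (e : OrthonormalBasis (Fin ℓ) ℝ V) (W : Subgroup (V ≃ₗᵢ[ℝ] V)) [Finite W]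
    (hW : Subgroup.closure {s | s ∈ W ∧ Dunkl.IsReflection s} = W)
    (hdist : ∀ d, Dunkl.IsDegrees e W d → Function.Injective d)
    (a : Fin ℓ → ℕ) :
    ∃ b, Dunkl.IsCanonicalInvariant e W a b ∧
      ∀ b', Dunkl.IsCanonicalInvariant e W a b' → ∃ z : ℂ, z ≠ 0 ∧ b' = z • b := by
  obtain ⟨d, u, hi, hu⟩ := Dunkl.exists_real_generators (e := e) hW
  have hd := hdist d ⟨_, hu⟩
  obtain ⟨b, hinv, hhom, hb⟩ := Dunkl.exists_isCanonical hi hu a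
  refine ⟨b, ⟨hinv, ⟨_, hhom⟩, fun d' u' hu' => hb.of_generators hu hu' hd⟩, ?_⟩
  intro b' hb'
  have hb' := hb'.2.2 d _ hu
  obtain ⟨y, hy, h1⟩ := hb.leading
  obtain ⟨z, hz, h2⟩ := hb'.leading
  refine ⟨z / y, div_ne_zero hz hy, ?_⟩
  rw [← sub_eq_zero]
  -- The factor `z / y` equalizes the leading coefficients, so the difference lies in the lower
  -- span.
  refine Dunkl.eq_zero_of_orthogonal hi e (a := a) ?_ fun a' ha' => ?_
  · have h3 := sub_mem h2 (Submodule.smul_of_tower_mem _ (z / y) h1)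
    rwa [smul_sub, ← mul_smul, div_mul_cancel₀ _ hy, sub_sub_sub_cancel_right] at h3
  · rw [← Dunkl.formBilin_apply, map_sub, ← algebraMap_smul (Dunkl.ParamField W) (z / y) b,
      map_smul, Dunkl.formBilin_apply, Dunkl.formBilin_apply, hb.orthogonal a' ha',
      hb'.orthogonal a' ha', smul_zero, sub_zero]
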